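/- An L-shape with parameters $\ell_x,\ell_y,w_x,w_y\in[0,1]$, where $0<w_x\le \ell_x$ and $0<w_y\le \ell_y$, is the union of an axis-parallel rectangle of width $\ell_x$ and height $w_y$ and an axis-parallel rectangle of width $w_x$ and height $\ell_y$ whose lower left corners coincide. It is small if $\ell_x,\ell_y\le \tfrac12$, large if $\ell_x,\ell_y\ge\tfrac12$, and symmetric if $\ell_x=\ell_y$ and $w_x=w_y$. In online bin packing of L-shapes, the L-shapes of a finite sequence arrive one after another, and each has to be placed irrevocably, by translation only, into a unit square bin (from an unbounded supply) before the next one is revealed; L-shapes in the same bin must have disjoint interiors. Let $\mathrm{OPT}$ denote the minimum number of bins in an offline packing of the sequence. **Theorem.** There is an online algorithm (deterministic) with a constant asymptotic competitive ratio on sequences in which every L-shape is symmetric or small: there are constants $c$ and $\beta>0$ such that it uses at most $c\cdot\mathrm{OPT}+\beta$ bins on every such sequence. In particular, there exist deterministic online algorithms that use at most (a) $33\cdot\mathrm{OPT}+2$ bins on every sequence of large and symmetric L-shapes; (b) $8\cdot\mathrm{OPT}+7$ bins on every sequence of small L-shapes; (c) $41\cdot\mathrm{OPT}+9$ bins on every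 sequence of symmetric L-shapes. -/

import Mathlib

namespace LBinPack

/-- An L-shape with arm lengths `lx, ly` and arm widths `wx, wy`, all in `[0,1]`: the union of an
axis-parallel rectangle of width `lx` and height `wy` and one of width `wx` and height `ly` with
the same lower left corner. The widths are positive: an L-shape is a (nondegenerate) polygon. -/
structure LShape where
  lx : ℝ
  ly : ℝ
  wx : ℝ
  wy : ℝ
  wx_pos : 0 < wx
  wy_pos : 0 < wy
  wx_le : wx ≤ lx
  wy_le : wy ≤ ly
  lx_le : lx ≤ 1
  ly_le : ly ≤ 1

namespace LShape

/-- Both arm lengths are at most `1/2`. -/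
def IsSmall (L : LShape) : Prop := L.lx ≤ 1 / 2 ∧ L.ly ≤ 1 / 2

/-- Both arm lengths are at least `1/2`. -/
def IsLarge (L : LShape) : Prop := 1 / 2 ≤ L.lx ∧ 1 / 2 ≤ L.ly

/-- Equal arm lengths and equal arm widths. -/
def IsSymmetric (L : LShape) : Prop := L.lx = L.ly ∧ L.wx = L.wy

/-- The closed region covered by `L` when its reference point (lower left corner) is at `(x, y)`. -/
def region (L : LShape) (x y : ℝ) : Set (ℝ × ℝ) :=
  (Set.Icc x (x + L.lx) ×ˢ Set.Icc y (y + L.wy)) ∪ (Set.Icc x (x + L.wx) ×ˢ Set.Icc y (y + L.ly))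

end LShape

/-- The unit square bin. -/
def unitBin : Set (ℝ × ℝ) := Set.Icc 0 1 ×ˢ Set.Icc 0 1

/-- A placement of an item by translation: the index of its bin (from an unbounded supply) and
the coordinates of its reference point in that bin. -/
structure Placement where
  bin : ℕ
  x : ℝ
  y : ℝ

/-- `p` is a valid packing of the sequence `σ`: every item lies inside the unit bin, and any two
items of the same bin have disjoint interiors. -/
def IsPacking (σ : List LShape) (p : Fin σ.length → Placement) : Prop :=
  (∀ i, (σ.get i).region (p i).x (p i).y ⊆ unitBin) ∧
  ∀ i j, i ≠ j → (p i).bin = (p j).bin →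
    Disjoint (interior ((σ.get i).region (p i).x (p i).y))
      (interior ((σ.get j).region (p j).x (p j).y))

/-- The number of bins that receive at least one item. -/
def numBins {n : ℕ} (p : Fin n → Placement) : ℕ :=
  (Finset.univ.image fun i => (p i).bin).card

/-- The minimum number of bins in a valid (offline) packing of `σ`. -/
noncomputable def OPT (σ : List LShape) : ℕ :=
  sInf {k | ∃ p, IsPacking σ p ∧ numBins p = k}

/-- The minimum is over a nonempty set: each item can be put into a bin of its own. -/
theorem OPT_attained (σ : List LShape) : ∃ p, IsPacking σ p ∧ numBins p = OPT σ := by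
  have hne : {k | ∃ p, IsPacking σ p ∧ numBins p = k}.Nonempty := by
    refine ⟨_, fun i => ⟨i, 0, 0⟩, ⟨?_, ?_⟩, rfl⟩
    · intro i q hq
      have h1 := (σ.get i).wx_le
      have h2 := (σ.get i).wy_le
      have h3 := (σ.get i).lx_le
      have h4 := (σ.get i).ly_le
      simp only [LShape.region, unitBin, Set.mem_union, Set.mem_prod, Set.mem_Icc] at hq ⊢
      rcases hq with ⟨⟨ha, hb⟩, hc, hd⟩ | ⟨⟨ha, hb⟩, hc, hd⟩ <;>
        exact ⟨⟨ha, by linarith⟩, hc, by linarith⟩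
    · intro i j hij h
      exact absurd (Fin.ext h) hij
  exact Nat.sInf_mem hne

/-- A deterministic online algorithm: the placement of an item, which is final, is a function of
the items that arrived before it (in order) and of the item itself. -/
def OnlineAlgorithm : Type := List LShape → LShape → Placement

/-- The placements that the algorithm makes when it is presented with the sequence `σ`. -/
def OnlineAlgorithm.run (A : OnlineAlgorithm) (σ : List LShape) : Fin σ.length → Placement :=
  fun i => A (σ.take i) (σ.get i)

/-- On every finite sequence of L-shapes that all have the property `P`, the algorithm `A`
produces a valid packing, which uses at most `c * OPT + β` bins. -/
def OnlineAlgorithm.PacksWithin (A : OnlineAlgorithm) (P : LShape → Prop) (c β : ℝ) : Prop :=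
  ∀ σ : List LShape, (∀ L ∈ σ, P L) →
    IsPacking σ (A.run σ) ∧ (numBins (A.run σ) : ℝ) ≤ c * (OPT σ : ℝ) + β

/-- `A` has asymptotic competitive ratio `c` on sequences of L-shapes with the property `P`. -/
def OnlineAlgorithm.HasAsymptoticRatio (A : OnlineAlgorithm) (P : LShape → Prop) (c : ℝ) : Prop :=
  ∃ β : ℝ, 0 < β ∧ A.PacksWithin P c β

end LBinPack

/-! Different kinds of items go to separate bins. `OPT` does not grow on subsequences, so ratios and
additive constants of the kinds add up. Every kind has its own lower bound on `OPT`.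

Large symmetric shapes with arm length above 1/2: two of them in one bin would cross unless one
corner lies beyond the other's vertical arm. So the widths `wx` form disjoint intervals on the
x-axis, all starting within the play `1 - lx`. If `wx` is at most a quarter of the play, items are
classed by the dyadic size of their play. Each class stacks along its own segment of the diagonal of
shared bins, so the number of bins is governed by the worst class rather than by the sum over
classes (`exists_nextFit`); this costs ratio 10. If `wx` is larger, the item is pushed to its
extreme position, and packing becomes online colouring of the intervals `[1 - lx, 1 - lx + wx)`. One
bin of any packing holds at most 5 items covering a common point, and the Kierstead–Trotter scheme
uses three colours per unit of clique size; this costs 15. Arm length exactly 1/2, where shapes can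
also lie side by side, is handled by area with ratio 4.

Small shapes: blocks of dyadic sides, obtained by repeated halving, hold items whose arms are
between a quarter and a half of the sides, stacked diagonally. A block is closed once it is filled
past half in one direction; its items then have arm area at least 1/8 of the block, and total arm
area is at most `OPT`. Blocks not closed have total area at most 7, because there are at most one
open and one fresh block of each size and no fresh full bin. -/

namespace LBinPack

/-! ### Online algorithms and invariants of their history -/

/-- An item together with the placement it received. -/
abbrev Entry := LShape × Placement

/-- The interior of a placed item, tagged with its bin. -/
def occ (e : Entry) : Set (ℕ × (ℝ × ℝ)) := {e.2.bin} ×ˢ interior (e.1.region e.2.x e.2.y)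

/-- A list of placed items that lie inside the bins and do not overlap. -/
structure Valid (h : List Entry) : Prop where
  fits : ∀ e ∈ h, e.1.region e.2.x e.2.y ⊆ unitBin
  disj : h.Pairwise fun e f => Disjoint (occ e) (occ f)

/-- The bins used by a list of placed items. -/
def usedBins (h : List Entry) : Finset ℕ := (h.map fun e => e.2.bin).toFinset

/-- Tagging points with their bin turns the conditional non-overlap into plain disjointness of sets,
which passes to subsets directly. -/
theorem disjoint_occ {e f : Entry} (h : e.2.bin = f.2.bin →
    Disjoint (interior (e.1.region e.2.x e.2.y)) (interior (f.1.region f.2.x f.2.y))) :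
    Disjoint (occ e) (occ f) := by
  rw [Set.disjoint_left]
  rintro ⟨n, q⟩ ⟨h1, h2⟩ ⟨h3, h4⟩
  simp only [Set.mem_singleton_iff] at h1 h3
  exact Set.disjoint_left.1 (h (h1.symm.trans h3)) h2 h4

theorem disjoint_interior_of_occ {e f : Entry} (h : Disjoint (occ e) (occ f))
    (hb : e.2.bin = f.2.bin) :
    Disjoint (interior (e.1.region e.2.x e.2.y)) (interior (f.1.region f.2.x f.2.y)) := by
  rw [Set.disjoint_left] at h ⊢
  intro q h1 h2
  exact h (a := (e.2.bin, q)) ⟨rfl, h1⟩ ⟨hb, h2⟩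

theorem valid_nil : Valid [] := ⟨by simp, by simp⟩

theorem Valid.concat {h : List Entry} {e : Entry} (hv : Valid h)
    (hf : e.1.region e.2.x e.2.y ⊆ unitBin) (hd : ∀ f ∈ h, Disjoint (occ f) (occ e)) :
    Valid (h ++ [e]) := by
  refine ⟨?_, ?_⟩
  · intro f hfm
    rcases List.mem_append.1 hfm with h1 | h1
    · exact hv.fits f h1
    · rw [List.mem_singleton.1 h1]; exact hf
  · rw [List.pairwise_append]
    refine ⟨hv.disj, by simp, ?_⟩
    intro f h1 g h2
    rw [List.mem_singleton.1 h2]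
    exact hd f h1

/-- The items of `σ` with the placements that `A` gives them. -/
def OnlineAlgorithm.trace (A : OnlineAlgorithm) (σ : List LShape) : List Entry :=
  List.ofFn fun i : Fin σ.length => (σ.get i, A.run σ i)

theorem OnlineAlgorithm.trace_getElem (A : OnlineAlgorithm) (σ : List LShape) (n : ℕ)
    (h : n < (A.trace σ).length) (h' : n < σ.length) :
    (A.trace σ)[n] = (σ[n], A (σ.take n) σ[n]) :=
  List.getElem_ofFn h

theorem OnlineAlgorithm.mem_trace (A : OnlineAlgorithm) (σ : List LShape) (i : Fin σ.length) :
    (σ.get i, A.run σ i) ∈ A.trace σ :=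
  List.mem_ofFn.2 ⟨i, rfl⟩

theorem OnlineAlgorithm.trace_concat (A : OnlineAlgorithm) (σ : List LShape) (L : LShape) :
    A.trace (σ ++ [L]) = A.trace σ ++ [(L, A σ L)] := by
  have hl : ∀ τ, (A.trace τ).length = τ.length := fun τ => List.length_ofFn
  apply List.ext_getElem
  · simp [hl]
  · intro n h1 h2
    have hn : n < σ.length + 1 := by simpa [hl] using h1
    rcases Nat.lt_succ_iff_lt_or_eq.1 hn with h | rfl
    · rw [List.getElem_append_left (by simpa [hl] using h)]
      rw [trace_getElem A _ n _ (by simpa using hn), trace_getElem A _ n _ h]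
      simp [List.getElem_append_left h, List.take_append_of_le_length h.le]
    · rw [List.getElem_append_right (by simp [hl])]
      rw [trace_getElem A _ _ _ (by simp)]
      simp [hl]

theorem OnlineAlgorithm.map_fst_trace (A : OnlineAlgorithm) (σ : List LShape) :
    (A.trace σ).map Prod.fst = σ := by
  induction σ using List.reverseRecOn with
  | nil => rfl
  | append_singleton σ L ih => rw [trace_concat, List.map_append, ih]; rfl

theorem OnlineAlgorithm.isPacking_iff (A : OnlineAlgorithm) (σ : List LShape) :
    IsPacking σ (A.run σ) ↔ Valid (A.trace σ) := by
  constructor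
  · rintro ⟨h1, h2⟩
    refine ⟨?_, ?_⟩
    · intro e he
      obtain ⟨i, hi⟩ := List.mem_ofFn.1 he
      rw [← hi]
      exact h1 i
    · rw [trace, List.pairwise_ofFn]
      intro i j hij
      exact disjoint_occ (h2 i j hij.ne)
  · rintro ⟨h1, h2⟩
    rw [trace, List.pairwise_ofFn] at h2
    refine ⟨fun i => h1 _ (A.mem_trace σ i), ?_⟩
    intro i j hij hb
    rcases lt_or_gt_of_ne hij with h | h
    · exact disjoint_interior_of_occ (e := (σ.get i, A.run σ i)) (f := (σ.get j, A.run σ j))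
        (h2 h) hb
    · exact (disjoint_interior_of_occ (e := (σ.get j, A.run σ j)) (f := (σ.get i, A.run σ i))
        (h2 h) hb.symm).symm

theorem OnlineAlgorithm.numBins_run (A : OnlineAlgorithm) (σ : List LShape) :
    numBins (A.run σ) = (usedBins (A.trace σ)).card := by
  unfold numBins usedBins
  congr 1
  ext n
  simp [trace, List.mem_ofFn]

open Classical in
/-- An invariant that can be maintained whatever item arrives yields an online algorithm. -/
theorem exists_online (P : LShape → Prop) (c β : ℝ) (Inv : List Entry → Prop) (h0 : Inv [])
    (step : ∀ h L, Inv h → P L → ∃ p, Inv (h ++ [(L, p)]))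
    (fin : ∀ h, Inv h → Valid h ∧ ((usedBins h).card : ℝ) ≤ c * OPT (h.map Prod.fst) + β) :
    ∃ A : OnlineAlgorithm, A.PacksWithin P c β := by
  -- The default placement is never used on admissible sequences, where the invariant holds
  -- throughout.
  let pick : List Entry → LShape → Placement := fun h L =>
    if H : Inv h ∧ P L then (step h L H.1 H.2).choose else ⟨0, 0, 0⟩
  -- An online algorithm sees only the items, so it replays its own earlier choices to recover their
  -- placements.
  let tr : List LShape → List Entry := List.foldl (fun h L => h ++ [(L, pick h L)]) []
  let A : OnlineAlgorithm := fun σ L => pick (tr σ) L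
  have htr : ∀ σ, A.trace σ = tr σ := by
    intro σ
    induction σ using List.reverseRecOn with
    | nil => rfl
    | append_singleton σ L ih =>
      rw [OnlineAlgorithm.trace_concat, ih]
      simp [tr, A]
  have hinv : ∀ σ : List LShape, (∀ L ∈ σ, P L) → Inv (A.trace σ) := by
    intro σ
    induction σ using List.reverseRecOn with
    | nil => intro _; exact h0
    | append_singleton σ L ih =>
      intro hσ
      have h1 := ih fun K hK => hσ K (List.mem_append_left _ hK)
      have h2 : P L := hσ L (by simp)
      rw [OnlineAlgorithm.trace_concat]
      have h3 : A σ L = (step _ L h1 h2).choose := by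
        have : A σ L = pick (A.trace σ) L := by rw [htr]
        rw [this]
        exact dif_pos ⟨h1, h2⟩
      rw [h3]
      exact (step _ L h1 h2).choose_spec
  refine ⟨A, fun σ hσ => ?_⟩
  obtain ⟨h1, h2⟩ := fin _ (hinv σ hσ)
  rw [OnlineAlgorithm.map_fst_trace] at h2
  rw [A.isPacking_iff, A.numBins_run]
  exact ⟨h1, h2⟩

/-! ### Running algorithms side by side -/

theorem OPT_mono {τ σ : List LShape} (h : τ.Sublist σ) : OPT τ ≤ OPT σ := by
  obtain ⟨f, hf⟩ := List.sublist_iff_exists_fin_orderEmbedding_get_eq.1 h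
  obtain ⟨p, hp, hn⟩ := OPT_attained σ
  rw [← hn]
  have hle : OPT τ ≤ numBins fun i => p (f i) := by
    refine Nat.sInf_le ⟨fun i => p (f i), ⟨?_, ?_⟩, rfl⟩
    · intro i
      rw [hf]
      exact hp.1 (f i)
    · intro i j hij hb
      rw [hf, hf]
      exact hp.2 (f i) (f j) (fun h => hij (f.injective h)) hb
  refine hle.trans ?_
  apply Finset.card_le_card
  intro n hn
  simp only [Finset.mem_image, Finset.mem_univ, true_and] at hn ⊢
  obtain ⟨i, hi⟩ := hn
  exact ⟨f i, hi⟩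

theorem OnlineAlgorithm.PacksWithin.mono {A : OnlineAlgorithm} {P Q : LShape → Prop}
    {c c' β β' : ℝ} (hA : A.PacksWithin P c β) (hQ : ∀ L, Q L → P L) (hc : c ≤ c')
    (hβ : β ≤ β') : A.PacksWithin Q c' β' := by
  intro σ hσ
  obtain ⟨h1, h2⟩ := hA σ fun L hL => hQ L (hσ L hL)
  refine ⟨h1, h2.trans ?_⟩
  gcongr

theorem pairwise_of_filter {α : Type*} {R : α → α → Prop} (p : α → Prop) [DecidablePred p]
    (hs : ∀ a b, p a → ¬ p b → R a b ∧ R b a) (l : List α)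
    (h1 : (l.filter fun a => p a).Pairwise R) (h2 : (l.filter fun a => ¬ p a).Pairwise R) :
    l.Pairwise R := by
  induction l with
  | nil => simp
  | cons a t ih =>
    by_cases ha : p a
    · simp only [List.filter_cons, ha, decide_true, if_true, List.pairwise_cons, not_true,
        decide_false] at h1 h2
      refine List.pairwise_cons.2 ⟨fun b hb => ?_, ih h1.2 (by simpa using h2)⟩
      by_cases hpb : p b
      · exact h1.1 b (by simp [hb, hpb])
      · exact (hs a b ha hpb).1
    · simp only [List.filter_cons, ha, decide_true, if_true, List.pairwise_cons, not_false_iff,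
        decide_false] at h1 h2
      refine List.pairwise_cons.2 ⟨fun b hb => ?_, ih (by simpa using h1) h2.2⟩
      by_cases hpb : p b
      · exact (hs b a hpb ha).2
      · exact h2.1 b (by simp [hb, hpb])

/-- Move a placed item to another bin. -/
def rebin (g : ℕ → ℕ) (e : Entry) : Entry := (e.1, ⟨g e.2.bin, e.2.x, e.2.y⟩)

theorem Valid.rebin {h : List Entry} (hv : Valid h) {g : ℕ → ℕ} (hg : g.Injective) :
    Valid (h.map (rebin g)) := by
  refine ⟨?_, ?_⟩
  · intro e he
    obtain ⟨f, hf, rfl⟩ := List.mem_map.1 he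
    exact hv.fits f hf
  · rw [List.pairwise_map]
    refine hv.disj.imp fun {e f} hd => disjoint_occ fun hb => ?_
    exact disjoint_interior_of_occ (e := e) (f := f) hd (hg hb)

open Classical in
/-- Two algorithms for two kinds of items can be run side by side, in separate bins. -/
theorem exists_packsWithin_or {A₁ A₂ : OnlineAlgorithm} {P₁ P₂ : LShape → Prop}
    {c₁ c₂ β₁ β₂ : ℝ} (hc₁ : 0 ≤ c₁) (hc₂ : 0 ≤ c₂) (h₁ : A₁.PacksWithin P₁ c₁ β₁)
    (h₂ : A₂.PacksWithin P₂ c₂ β₂) :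
    ∃ A : OnlineAlgorithm, A.PacksWithin (fun L => P₁ L ∨ P₂ L) (c₁ + c₂) (β₁ + β₂) := by
  let A : OnlineAlgorithm := fun σ L =>
    if P₁ L then (rebin (fun n => 2 * n) (L, A₁ (σ.filter fun K => P₁ K) L)).2
    else (rebin (fun n => 2 * n + 1) (L, A₂ (σ.filter fun K => ¬ P₁ K) L)).2
  have t₁ : ∀ σ, (A.trace σ).filter (fun e => P₁ e.1) =
      (A₁.trace (σ.filter fun K => P₁ K)).map (rebin fun n => 2 * n) := by
    intro σ
    induction σ using List.reverseRecOn with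
    | nil => rfl
    | append_singleton σ L ih =>
      rw [OnlineAlgorithm.trace_concat, List.filter_append, List.filter_append, ih]
      by_cases hL : P₁ L
      · simp only [List.filter_cons, hL, decide_true, if_true, List.filter_nil]
        rw [OnlineAlgorithm.trace_concat, List.map_append]
        simp [A, hL, rebin]
      · simp [hL]
  have t₂ : ∀ σ, (A.trace σ).filter (fun e => ¬ P₁ e.1) =
      (A₂.trace (σ.filter fun K => ¬ P₁ K)).map (rebin fun n => 2 * n + 1) := by
    intro σ
    induction σ using List.reverseRecOn with
    | nil => rfl
    | append_singleton σ L ih =>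
      rw [OnlineAlgorithm.trace_concat, List.filter_append, List.filter_append, ih]
      by_cases hL : P₁ L
      · simp [hL]
      · simp only [List.filter_cons, hL, not_false_iff, decide_true, if_true, List.filter_nil]
        rw [OnlineAlgorithm.trace_concat, List.map_append]
        simp [A, hL, rebin]
  have mem₁ : ∀ {σ e}, e ∈ A.trace σ → P₁ e.1 →
      e ∈ (A₁.trace (σ.filter fun K => P₁ K)).map (rebin fun n => 2 * n) := by
    intro σ e he hP
    rw [← t₁]
    simp [he, hP]
  have mem₂ : ∀ {σ e}, e ∈ A.trace σ → ¬ P₁ e.1 →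
      e ∈ (A₂.trace (σ.filter fun K => ¬ P₁ K)).map (rebin fun n => 2 * n + 1) := by
    intro σ e he hP
    rw [← t₂]
    simp [he, hP]
  refine ⟨A, fun σ hσ => ?_⟩
  obtain ⟨v₁, n₁⟩ := h₁ (σ.filter fun K => P₁ K) (fun L hL => by simpa using (List.mem_filter.1 hL).2)
  obtain ⟨v₂, n₂⟩ := h₂ (σ.filter fun K => ¬ P₁ K) (fun L hL => by
    obtain ⟨h3, h4⟩ := List.mem_filter.1 hL
    exact (hσ L h3).resolve_left (by simpa using h4))
  rw [A₁.isPacking_iff] at v₁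
  rw [A₂.isPacking_iff] at v₂
  rw [A₁.numBins_run] at n₁
  rw [A₂.numBins_run] at n₂
  rw [A.isPacking_iff, A.numBins_run]
  have w₁ := v₁.rebin (g := fun n => 2 * n) (fun a b h => by simpa using h)
  have w₂ := v₂.rebin (g := fun n => 2 * n + 1) (fun a b h => by simpa using h)
  refine ⟨⟨?_, ?_⟩, ?_⟩
  · intro e he
    by_cases hP : P₁ e.1
    · exact w₁.fits e (mem₁ he hP)
    · exact w₂.fits e (mem₂ he hP)
  · have key : ∀ e ∈ A.trace σ, (P₁ e.1 ↔ Even e.2.bin) := by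
      intro e he
      by_cases hP : P₁ e.1
      · obtain ⟨f, -, rfl⟩ := List.mem_map.1 (mem₁ he hP)
        simp only [hP, true_iff]
        exact even_two_mul _
      · obtain ⟨f, -, rfl⟩ := List.mem_map.1 (mem₂ he hP)
        simp only [hP, false_iff, Nat.not_even_iff_odd]
        exact odd_two_mul_add_one _
    have hcongr : ∀ e ∈ A.trace σ, decide (Even e.2.bin) = decide (P₁ e.1) := by
      intro e he
      simp [key e he]
    -- The split is by parity of the bin rather than by `P₁`: different parity alone forces
    -- different bins, for arbitrary entries.
    apply pairwise_of_filter (fun e : Entry => Even e.2.bin)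
    · intro e f he hf
      have : e.2.bin ≠ f.2.bin := fun h => hf (h ▸ he)
      exact ⟨disjoint_occ fun h => absurd h this, disjoint_occ fun h => absurd h.symm this⟩
    · rw [List.filter_congr hcongr, t₁]
      exact w₁.disj
    · rw [List.filter_congr (q := fun e => decide (¬ P₁ e.1)) (by
        intro e he; simp [key e he]), t₂]
      exact w₂.disj
  · have hsub : usedBins (A.trace σ) ⊆
        (usedBins (A₁.trace (σ.filter fun K => P₁ K))).image (fun n => 2 * n) ∪
        (usedBins (A₂.trace (σ.filter fun K => ¬ P₁ K))).image (fun n => 2 * n + 1) := by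
      intro n hn
      simp only [usedBins, List.mem_toFinset, List.mem_map] at hn
      obtain ⟨e, he, rfl⟩ := hn
      by_cases hP : P₁ e.1
      · obtain ⟨f, hf, rfl⟩ := List.mem_map.1 (mem₁ he hP)
        apply Finset.mem_union_left
        apply Finset.mem_image_of_mem
        simp only [usedBins, List.mem_toFinset, List.mem_map]
        exact ⟨f, hf, rfl⟩
      · obtain ⟨f, hf, rfl⟩ := List.mem_map.1 (mem₂ he hP)
        apply Finset.mem_union_right
        apply Finset.mem_image_of_mem (fun n => 2 * n + 1)
        simp only [usedBins, List.mem_toFinset, List.mem_map]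
        exact ⟨f, hf, rfl⟩
    have hcard := (Finset.card_le_card hsub).trans ((Finset.card_union_le _ _).trans
      (add_le_add Finset.card_image_le Finset.card_image_le))
    have hcard' : ((usedBins (A.trace σ)).card : ℝ) ≤
        (usedBins (A₁.trace (σ.filter fun K => P₁ K))).card +
        (usedBins (A₂.trace (σ.filter fun K => ¬ P₁ K))).card := by exact_mod_cast hcard
    have o₁ : (OPT (σ.filter fun K => P₁ K) : ℝ) ≤ OPT σ := by
      exact_mod_cast OPT_mono List.filter_sublist
    have o₂ : (OPT (σ.filter fun K => ¬ P₁ K) : ℝ) ≤ OPT σ := by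
      exact_mod_cast OPT_mono List.filter_sublist
    have m₁ := mul_le_mul_of_nonneg_left o₁ hc₁
    have m₂ := mul_le_mul_of_nonneg_left o₂ hc₂
    linarith

/-! ### Geometry of two L-shapes in one bin -/

theorem LShape.lx_pos (L : LShape) : 0 < L.lx := L.wx_pos.trans_le L.wx_le

theorem LShape.ly_pos (L : LShape) : 0 < L.ly := L.wy_pos.trans_le L.wy_le

theorem LShape.horizontal_subset (L : LShape) (x y : ℝ) :
    Set.Ioo x (x + L.lx) ×ˢ Set.Ioo y (y + L.wy) ⊆ interior (L.region x y) :=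
  interior_maximal
    ((Set.prod_mono Set.Ioo_subset_Icc_self Set.Ioo_subset_Icc_self).trans Set.subset_union_left)
    (isOpen_Ioo.prod isOpen_Ioo)

theorem LShape.vertical_subset (L : LShape) (x y : ℝ) :
    Set.Ioo x (x + L.wx) ×ˢ Set.Ioo y (y + L.ly) ⊆ interior (L.region x y) :=
  interior_maximal
    ((Set.prod_mono Set.Ioo_subset_Icc_self Set.Ioo_subset_Icc_self).trans Set.subset_union_right)
    (isOpen_Ioo.prod isOpen_Ioo)

theorem LShape.region_subset_box (L : LShape) (x y : ℝ) :
    L.region x y ⊆ Set.Icc x (x + L.lx) ×ˢ Set.Icc y (y + L.ly) := by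
  have h1 := L.wx_le
  have h2 := L.wy_le
  rintro ⟨a, b⟩ (⟨⟨h3, h4⟩, h5, h6⟩ | ⟨⟨h3, h4⟩, h5, h6⟩) <;>
    exact ⟨⟨h3, by dsimp at *; linarith⟩, h5, by dsimp at *; linarith⟩

theorem LShape.interior_region_subset (L : LShape) (x y : ℝ) :
    interior (L.region x y) ⊆ Set.Ioo x (x + L.lx) ×ˢ Set.Ioo y (y + L.ly) := by
  have := interior_mono (L.region_subset_box x y)
  rwa [interior_prod_eq, interior_Icc, interior_Icc] at this

theorem LShape.region_subset_unitBin {L : LShape} {x y : ℝ} (hx : 0 ≤ x) (hy : 0 ≤ y)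
    (hx' : x + L.lx ≤ 1) (hy' : y + L.ly ≤ 1) : L.region x y ⊆ unitBin :=
  (L.region_subset_box x y).trans
    (Set.prod_mono (Set.Icc_subset_Icc hx hx') (Set.Icc_subset_Icc hy hy'))

theorem LShape.of_region_subset_unitBin {L : LShape} {x y : ℝ} (h : L.region x y ⊆ unitBin) :
    0 ≤ x ∧ 0 ≤ y ∧ x + L.lx ≤ 1 ∧ y + L.ly ≤ 1 := by
  have h1 := L.lx_pos
  have h2 := L.ly_pos
  have h3 := L.wx_pos
  have h4 := L.wy_pos
  have a : (x, y) ∈ unitBin := h (Or.inl ⟨⟨le_rfl, by dsimp; linarith⟩, le_rfl, by dsimp; linarith⟩)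
  have b : (x + L.lx, y) ∈ unitBin :=
    h (Or.inl ⟨⟨by dsimp; linarith, le_rfl⟩, le_rfl, by dsimp; linarith⟩)
  have c : (x, y + L.ly) ∈ unitBin :=
    h (Or.inr ⟨⟨le_rfl, by dsimp; linarith⟩, by dsimp; linarith, le_rfl⟩)
  exact ⟨a.1.1, a.2.1, b.1.2, c.2.2⟩

/-- An L-shape and everything to the upper right of its notch do not overlap. -/
theorem LShape.disjoint_notch {L : LShape} {x y a b : ℝ} (hx : x + L.wx ≤ a) (hy : y + L.wy ≤ b) :
    Disjoint (interior (L.region x y)) (Set.Ioi a ×ˢ Set.Ioi b) := by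
  rw [Set.disjoint_left]
  rintro ⟨p, q⟩ h1 ⟨h2, h3⟩
  simp only [Set.mem_Ioi] at h2 h3
  rcases interior_subset h1 with ⟨-, -, h⟩ | ⟨⟨-, h⟩, -⟩ <;> dsimp at h <;> linarith

theorem LShape.disjoint_of_nested {L K : LShape} {x y x' y' : ℝ} (hx : x + L.wx ≤ x')
    (hy : y + L.wy ≤ y') :
    Disjoint (interior (L.region x y)) (interior (K.region x' y')) :=
  (LShape.disjoint_notch hx hy).mono_right ((K.interior_region_subset x' y').trans
    (Set.prod_mono Set.Ioo_subset_Ioi_self Set.Ioo_subset_Ioi_self))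

/-- Two L-shapes whose arms are longer than `1/2` can share a bin only if they are nested. -/
theorem LShape.nested_of_disjoint {L K : LShape} {x y x' y' : ℝ} (hL : 1 / 2 < L.ly)
    (hK : 1 / 2 < K.lx) (hK' : 1 / 2 < K.ly) (hLx : 1 / 2 < L.lx)
    (h1 : L.region x y ⊆ unitBin) (h2 : K.region x' y' ⊆ unitBin)
    (hd : Disjoint (interior (L.region x y)) (interior (K.region x' y'))) (hy : y ≤ y') :
    x + L.wx ≤ x' := by
  by_contra! hx
  obtain ⟨a1, a2, a3, a4⟩ := LShape.of_region_subset_unitBin h1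
  obtain ⟨b1, b2, b3, b4⟩ := LShape.of_region_subset_unitBin h2
  have c1 := L.wx_pos
  have c2 := K.wy_pos
  -- Corners have coordinates below 1/2 and arms are longer than that, so the vertical arm of `L`
  -- crosses the horizontal arm of `K`; `(u, v)` is a point of the crossing.
  obtain ⟨u, hu1, hu2⟩ := exists_between (show max x x' < min (x + L.wx) (x' + K.lx) by
    rw [max_lt_iff, lt_min_iff, lt_min_iff]
    refine ⟨⟨?_, ?_⟩, ?_, ?_⟩ <;> linarith)
  obtain ⟨v, hv1, hv2⟩ := exists_between (show y' < min (y + L.ly) (y' + K.wy) by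
    rw [lt_min_iff]
    refine ⟨?_, ?_⟩ <;> linarith)
  rw [max_lt_iff] at hu1
  rw [lt_min_iff] at hu2 hv2
  exact Set.disjoint_left.1 hd
    (L.vertical_subset x y (a := (u, v)) ⟨⟨hu1.1, hu2.1⟩, ⟨hy.trans_lt hv1, hv2.1⟩⟩)
    (K.horizontal_subset x' y' ⟨⟨hu1.2, hu2.2⟩, ⟨hv1, hv2.2⟩⟩)

theorem LShape.separated_of_disjoint {L K : LShape} {x y x' y' : ℝ}
    (sL : L.IsSymmetric) (sK : K.IsSymmetric) (hL : 1 / 2 < L.lx) (hK : 1 / 2 < K.lx)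
    (h1 : L.region x y ⊆ unitBin) (h2 : K.region x' y' ⊆ unitBin)
    (hd : Disjoint (interior (L.region x y)) (interior (K.region x' y'))) :
    x + L.wx ≤ x' ∨ x' + K.wx ≤ x := by
  have hL' := sL.1 ▸ hL
  have hK' := sK.1 ▸ hK
  rcases le_total y y' with h | h
  · exact Or.inl (LShape.nested_of_disjoint hL' hK hK' hL h1 h2 hd h)
  · exact Or.inr (LShape.nested_of_disjoint hK' hL hL' hK h2 h1 hd.symm h)

/-! ### Lower bounds on the optimum -/

/-- A quantity that is at most `K` in every bin is at most `K * OPT` in total. -/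
theorem sum_le_mul_OPT (σ : List LShape) (f : LShape → ℝ) (K : ℝ)
    (hK : ∀ (s : Finset (Fin σ.length)) (x y : Fin σ.length → ℝ),
      (∀ i ∈ s, (σ.get i).region (x i) (y i) ⊆ unitBin) →
      (∀ i ∈ s, ∀ j ∈ s, i ≠ j → Disjoint (interior ((σ.get i).region (x i) (y i)))
        (interior ((σ.get j).region (x j) (y j)))) →
      ∑ i ∈ s, f (σ.get i) ≤ K) :
    (σ.map f).sum ≤ K * OPT σ := by
  obtain ⟨p, hp, hn⟩ := OPT_attained σ
  have h1 : (σ.map f).sum = ∑ i : Fin σ.length, f (σ.get i) := by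
    simp
  rw [h1, ← Finset.sum_fiberwise_of_maps_to (t := Finset.univ.image fun i => (p i).bin)
    (g := fun i => (p i).bin) (fun i _ => Finset.mem_image_of_mem _ (Finset.mem_univ i))]
  refine (Finset.sum_le_card_nsmul _ _ K ?_).trans ?_
  · intro b _
    apply hK _ (fun i => (p i).x) (fun i => (p i).y)
    · intro i _
      exact hp.1 i
    · intro i hi j hj hij
      simp only [Finset.mem_filter, Finset.mem_univ, true_and] at hi hj
      exact hp.2 i j hij (hi.trans hj.symm)
  · rw [nsmul_eq_mul, ← hn, numBins, mul_comm]

/-- The area of the larger arm of an L-shape. -/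
noncomputable def LShape.weight (L : LShape) : ℝ := max (L.lx * L.wy) (L.wx * L.ly)

open MeasureTheory in
theorem LShape.weight_le_volume (L : LShape) (x y : ℝ) :
    ENNReal.ofReal L.weight ≤ volume (interior (L.region x y)) := by
  rcases max_choice (L.lx * L.wy) (L.wx * L.ly) with h | h <;> rw [LShape.weight, h]
  · refine le_trans (le_of_eq ?_) (measure_mono (L.horizontal_subset x y))
    rw [Measure.volume_eq_prod, Measure.prod_prod, Real.volume_Ioo, Real.volume_Ioo,
      ENNReal.ofReal_mul L.lx_pos.le]
    simp
  · refine le_trans (le_of_eq ?_) (measure_mono (L.vertical_subset x y))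
    rw [Measure.volume_eq_prod, Measure.prod_prod, Real.volume_Ioo, Real.volume_Ioo,
      ENNReal.ofReal_mul L.wx_pos.le]
    simp

theorem LShape.weight_pos (L : LShape) : 0 < L.weight :=
  lt_max_of_lt_left (mul_pos L.lx_pos L.wy_pos)

-- Area bound: the interiors in one bin are disjoint, lie in a square of area 1, and each has area
-- at least the weight.
open MeasureTheory in
theorem sum_weight_le_OPT (σ : List LShape) : (σ.map LShape.weight).sum ≤ OPT σ := by
  rw [← one_mul (OPT σ : ℝ)]
  apply sum_le_mul_OPT
  intro s x y h1 h2
  rw [← ENNReal.ofReal_le_ofReal_iff zero_le_one,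
    ENNReal.ofReal_sum_of_nonneg fun i _ => (LShape.weight_pos _).le]
  calc ∑ i ∈ s, ENNReal.ofReal (σ.get i).weight
      ≤ ∑ i ∈ s, volume (interior ((σ.get i).region (x i) (y i))) :=
        Finset.sum_le_sum fun i _ => LShape.weight_le_volume _ _ _
    _ = volume (⋃ i ∈ s, interior ((σ.get i).region (x i) (y i))) :=
        (measure_biUnion_finset (fun i hi j hj hij => h2 i hi j hj hij)
          fun i _ => isOpen_interior.measurableSet).symm
    _ ≤ volume unitBin :=
        measure_mono (Set.iUnion₂_subset fun i hi => interior_subset.trans (h1 i hi))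
    _ ≤ ENNReal.ofReal 1 := by
        rw [unitBin, Measure.volume_eq_prod, Measure.prod_prod, Real.volume_Icc]
        simp

/-- Induction on the item with the largest start: all others end before it starts, so its start
bounds their total width. Hence `u` must vary in the induction. -/
theorem sum_le_of_separated {ι : Type*} [DecidableEq ι] (I : Finset ι) (s w : ι → ℝ)
    (hw : ∀ i ∈ I, 0 < w i) (hs : ∀ i ∈ I, 0 ≤ s i)
    (hd : ∀ i ∈ I, ∀ j ∈ I, i ≠ j → s i + w i ≤ s j ∨ s j + w j ≤ s i) :
    ∀ u, 0 ≤ u → (∀ i ∈ I, s i + w i ≤ u) → ∑ i ∈ I, w i ≤ u := by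
  induction I using Finset.induction_on_max_value s with
  | empty => intro u hu _; simpa using hu
  | insert a I ha hmax ih =>
    intro u _ h
    have hI : ∑ i ∈ I, w i ≤ s a := by
      refine ih (fun i hi => hw i (Finset.mem_insert_of_mem hi))
        (fun i hi => hs i (Finset.mem_insert_of_mem hi))
        (fun i hi j hj => hd i (Finset.mem_insert_of_mem hi) j (Finset.mem_insert_of_mem hj))
        _ (hs a (Finset.mem_insert_self _ _)) ?_
      intro i hi
      have hne : i ≠ a := fun h => ha (h ▸ hi)
      rcases hd i (Finset.mem_insert_of_mem hi) a (Finset.mem_insert_self _ _) hne with h1 | h1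
      · exact h1
      · have := hmax i hi
        have := hw a (Finset.mem_insert_self _ _)
        linarith
    rw [Finset.sum_insert ha]
    have := h a (Finset.mem_insert_self _ _)
    linarith

/-- The total width of items that start by `t` in one bin is at most `t` plus the largest width. -/
theorem sum_width_le_of_start_le {ι : Type*} [DecidableEq ι] (I : Finset ι) (s w : ι → ℝ)
    (hw : ∀ i ∈ I, 0 < w i) (hs : ∀ i ∈ I, 0 ≤ s i)
    (hd : ∀ i ∈ I, ∀ j ∈ I, i ≠ j → s i + w i ≤ s j ∨ s j + w j ≤ s i) {t W : ℝ}
    (hW : ∀ i ∈ I, w i ≤ W) (ht : ∀ i ∈ I, s i ≤ t) (hu : 0 ≤ t + W) :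
    ∑ i ∈ I, w i ≤ t + W :=
  sum_le_of_separated I s w hw hs hd _ hu fun i hi => add_le_add (ht i hi) (hW i hi)

/-- At most `n + 1` items wider than `t / n` can start by `t` in one bin. -/
theorem card_le_of_start_le {ι : Type*} [DecidableEq ι] (I : Finset ι) (s w : ι → ℝ)
    (hw : ∀ i ∈ I, 0 < w i) (hs : ∀ i ∈ I, 0 ≤ s i)
    (hd : ∀ i ∈ I, ∀ j ∈ I, i ≠ j → s i + w i ≤ s j ∨ s j + w j ≤ s i) {t : ℝ} {n : ℕ}
    (hW : ∀ i ∈ I, t < n * w i) (ht : ∀ i ∈ I, s i ≤ t) : I.card ≤ n := by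
  rcases I.eq_empty_or_nonempty with rfl | hne
  · simp
  obtain ⟨a, ha, hmin⟩ := I.exists_min_image w hne
  have ht0 : 0 ≤ t := (hs a ha).trans (ht a ha)
  -- Shrinking all widths to the smallest one keeps the intervals disjoint and makes the sum a
  -- multiple of the cardinality.
  have h := sum_width_le_of_start_le I s (fun _ => w a) (fun _ _ => hw a ha) hs
    (fun i hi j hj hij => (hd i hi j hj hij).imp (fun h => by have := hmin i hi; linarith)
      fun h => by have := hmin j hj; linarith)
    (W := w a) (fun _ _ => le_rfl) ht (by have := hw a ha; linarith)
  rw [Finset.sum_const, nsmul_eq_mul] at h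
  have h2 := hW a ha
  have h3 : (I.card : ℝ) < n + 1 := by
    by_contra! h4
    have := mul_le_mul_of_nonneg_right h4 (hw a ha).le
    linarith
  exact_mod_cast Nat.lt_succ_iff.1 (by exact_mod_cast h3)

/-! ### Large symmetric shapes: stacks on the diagonal -/

/-- Symmetric items of class `k` are stacked along the diagonal of the current bin of their class,
from `A k` on, until the stack is longer than `T k`; different classes use disjoint parts
`[A k, E k]` of the diagonal of each bin. -/
theorem exists_nextFit {ι : Type*} [DecidableEq ι] (cls : LShape → ι) (A T E : ι → ℝ) (C : ℝ) (P : LShape → Prop)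
    (hsym : ∀ L, P L → L.IsSymmetric) (hA : ∀ k, 0 ≤ A k) (hT : ∀ k, 0 < T k)
    (hstart : ∀ L, P L → A (cls L) + T (cls L) ≤ 1 - L.lx)
    (hend : ∀ L, P L → A (cls L) + T (cls L) + L.wx ≤ E (cls L))
    (hsep : ∀ k l, k ≠ l → E k ≤ A l ∨ E l ≤ A k) (hC : 0 ≤ C)
    (hopt : ∀ σ : List LShape, (∀ L ∈ σ, P L) → ∀ k,
      (σ.map fun L => if cls L = k then L.wx else 0).sum ≤ T k * C * OPT σ) :
    ∃ B : OnlineAlgorithm, B.PacksWithin P C 1 := by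
  let W : List Entry → ι → ℝ := fun h k =>
    ((h.map Prod.fst).map fun L => if cls L = k then L.wx else 0).sum
  have hW : ∀ h L p k, W (h ++ [(L, p)]) k = W h k + if cls L = k then L.wx else 0 := by
    intro h L p k
    simp [W]
  -- `b k` is the current bin of class `k` and `l k` the length of its stack there; the `b k`
  -- earlier bins each account for width at least `T k`.
  refine exists_online P C 1 (fun h => Valid h ∧ (∀ e ∈ h, P e.1) ∧ ∃ (b : ι → ℕ) (l : ι → ℝ),
    (∀ k, 0 ≤ l k ∧ l k ≤ T k ∧ b k * T k + l k ≤ W h k) ∧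
    ∀ e ∈ h, e.2.bin ≤ b (cls e.1) ∧ e.2.y = e.2.x ∧ A (cls e.1) ≤ e.2.x ∧
      e.2.x + e.1.wx ≤ E (cls e.1) ∧
      (e.2.bin = b (cls e.1) → e.2.x + e.1.wx ≤ A (cls e.1) + l (cls e.1))) ?_ ?_ ?_
  · refine ⟨valid_nil, by simp, fun _ => 0, fun _ => 0, fun k => ⟨le_rfl, (hT k).le, ?_⟩, by simp⟩
    simp [W]
  · rintro h L ⟨hv, hP, b, l, hbl, hpos⟩ hL
    obtain ⟨l0, lT, lW⟩ := hbl (cls L)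
    have hs := hstart L hL
    have he := hend L hL
    have hAk := hA (cls L)
    have hwx := L.wx_pos
    obtain ⟨e1, e2⟩ := hsym L hL
    refine ⟨⟨b (cls L), A (cls L) + l (cls L), A (cls L) + l (cls L)⟩, ?_, ?_, ?_⟩
    · refine hv.concat ?_ ?_
      · apply LShape.region_subset_unitBin <;> dsimp <;> linarith
      · intro f hf
        apply disjoint_occ
        intro hb
        obtain ⟨-, f2, f3, f4, f5⟩ := hpos f hf
        have g := (hsym _ (hP f hf)).2
        by_cases hc : cls f.1 = cls L
        · rw [hc] at f5
          have := f5 hb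
          apply LShape.disjoint_of_nested <;> dsimp <;> linarith
        · rcases hsep _ _ hc with h1 | h1
          · apply LShape.disjoint_of_nested <;> dsimp <;> linarith
          · apply Disjoint.symm
            apply LShape.disjoint_of_nested <;> dsimp <;> linarith
    · intro e he'
      rcases List.mem_append.1 he' with h1 | h1
      · exact hP e h1
      · rw [List.mem_singleton.1 h1]; exact hL
    · by_cases hfit : l (cls L) + L.wx ≤ T (cls L)
      · refine ⟨b, Function.update l (cls L) (l (cls L) + L.wx), ?_, ?_⟩
        · intro k
          rw [hW]
          by_cases hk : k = cls L
          · subst hk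
            simp only [Function.update_self, if_true]
            exact ⟨by linarith, hfit, by linarith⟩
          · rw [Function.update_of_ne hk, if_neg (Ne.symm hk), add_zero]
            exact hbl k
        · intro e he'
          rcases List.mem_append.1 he' with h1 | h1
          · obtain ⟨f1, f2, f3, f4, f5⟩ := hpos e h1
            refine ⟨f1, f2, f3, f4, fun hb => ?_⟩
            by_cases hk : cls e.1 = cls L
            · have := f5 hb
              rw [hk, Function.update_self]
              rw [hk] at this
              linarith
            · rw [Function.update_of_ne hk]
              exact f5 hb
          · rw [List.mem_singleton.1 h1]
            simp only [Function.update_self]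
            exact ⟨le_rfl, trivial, by linarith, by linarith, fun _ => by linarith⟩
      · refine ⟨Function.update b (cls L) (b (cls L) + 1), Function.update l (cls L) 0, ?_, ?_⟩
        · intro k
          rw [hW]
          by_cases hk : k = cls L
          · subst hk
            simp only [Function.update_self, if_true]
            push_cast
            exact ⟨le_rfl, (hT _).le, by linarith⟩
          · rw [Function.update_of_ne hk, Function.update_of_ne hk, if_neg (Ne.symm hk), add_zero]
            exact hbl k
        · intro e he'
          rcases List.mem_append.1 he' with h1 | h1
          · obtain ⟨f1, f2, f3, f4, f5⟩ := hpos e h1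
            by_cases hk : cls e.1 = cls L
            · rw [hk] at f1 f3 f4 ⊢
              simp only [Function.update_self]
              exact ⟨by omega, f2, f3, f4, fun hb => by omega⟩
            · rw [Function.update_of_ne hk, Function.update_of_ne hk]
              exact ⟨f1, f2, f3, f4, f5⟩
          · rw [List.mem_singleton.1 h1]
            simp only [Function.update_self]
            exact ⟨by omega, trivial, by linarith, by linarith, fun hb => by omega⟩
  · rintro h ⟨hv, hP, b, l, hbl, hpos⟩
    refine ⟨hv, ?_⟩
    have hb : ∀ k, (b k : ℝ) ≤ C * OPT (h.map Prod.fst) := by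
      intro k
      obtain ⟨l0, lT, lW⟩ := hbl k
      have h1 := hopt (h.map Prod.fst) (fun L hL => by
        obtain ⟨e, he, rfl⟩ := List.mem_map.1 hL
        exact hP e he) k
      have h2 : T k * b k ≤ T k * (C * OPT (h.map Prod.fst)) := by
        have : b k * T k + l k ≤ T k * C * OPT (h.map Prod.fst) := lW.trans h1
        linarith
      exact le_of_mul_le_mul_left h2 (hT k)
    -- All classes number the same bins from 0, so the bound on a single `b k` bounds every index;
    -- the extra 1 is for bin 0.
    have hsub : usedBins h ⊆ Finset.range (⌊C * OPT (h.map Prod.fst)⌋₊ + 1) := by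
      intro n hn
      simp only [usedBins, List.mem_toFinset, List.mem_map] at hn
      obtain ⟨e, he, rfl⟩ := hn
      rw [Finset.mem_range, Nat.lt_succ_iff]
      exact (hpos e he).1.trans (Nat.le_floor (hb _))
    have h1 := Finset.card_le_card hsub
    rw [Finset.card_range] at h1
    have h2 : ((usedBins h).card : ℝ) ≤ ⌊C * OPT (h.map Prod.fst)⌋₊ + 1 := by exact_mod_cast h1
    have h3 := Nat.floor_le (mul_nonneg hC (Nat.cast_nonneg (α := ℝ) (OPT (h.map Prod.fst))))
    linarith

/-- Symmetric L-shapes with arm length exactly `1/2`. -/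
theorem exists_packsWithin_half :
    ∃ B : OnlineAlgorithm, B.PacksWithin (fun L => L.IsSymmetric ∧ L.lx = 1 / 2) 4 1 := by
  -- Starts up to 1/2 fit since the play is 1/2. A width is twice the area of an arm, so the total
  -- width is at most `2 * OPT`, that is, `T * 4 * OPT` with `T = 1/2`.
  refine exists_nextFit (fun _ => ()) (fun _ => 0) (fun _ => 1 / 2) (fun _ => 1) 4 _
    (fun L h => h.1) (fun _ => le_rfl) (fun _ => by norm_num) ?_ ?_ ?_ (by norm_num) ?_
  · rintro L ⟨-, h⟩
    rw [h]; norm_num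
  · rintro L ⟨-, h⟩
    have := L.wx_le
    rw [h] at this
    linarith
  · intro k l h
    exact absurd rfl h
  · intro σ hσ k
    have h1 := sum_weight_le_OPT σ
    have h2 : (σ.map fun L => if (() : Unit) = k then L.wx else 0).sum ≤
        (σ.map fun L => 2 * L.weight).sum := by
      apply List.sum_le_sum
      intro L hL
      obtain ⟨⟨h3, h4⟩, h5⟩ := hσ L hL
      have : L.lx * L.wy ≤ L.weight := le_max_left _ _
      rw [← h4, h5] at this
      simp only [if_true]
      linarith
    rw [List.sum_map_mul_left] at h2
    exact h2.trans (by linarith)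

theorem exists_dyadic_class {d : ℝ} (h0 : 0 < d) (h1 : d ≤ 1) :
    ∃ k : ℕ, (1 / 2 : ℝ) ^ k / 2 < d ∧ d ≤ (1 / 2 : ℝ) ^ k := by
  obtain ⟨n, h2, h3⟩ := exists_nat_pow_near_of_lt_one h0 h1 (y := 1 / 2) (by norm_num) (by norm_num)
  exact ⟨n, by rw [pow_succ] at h2; linarith, h3⟩

/-- Long symmetric items of one bin occupy disjoint horizontal intervals at their corners. -/
theorem LShape.pairwise_separated {n : ℕ} {σ : Fin n → LShape} {s : Finset (Fin n)}
    {x y : Fin n → ℝ}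
    (hf : ∀ i ∈ s, (σ i).region (x i) (y i) ⊆ unitBin)
    (hd : ∀ i ∈ s, ∀ j ∈ s, i ≠ j → Disjoint (interior ((σ i).region (x i) (y i)))
      (interior ((σ j).region (x j) (y j))))
    (hL : ∀ i ∈ s, (σ i).IsSymmetric ∧ 1 / 2 < (σ i).lx) :
    ∀ i ∈ s, ∀ j ∈ s, i ≠ j → x i + (σ i).wx ≤ x j ∨ x j + (σ j).wx ≤ x i :=
  fun i hi j hj hij => LShape.separated_of_disjoint (hL i hi).1 (hL j hj).1 (hL i hi).2
    (hL j hj).2 (hf i hi) (hf j hj) (hd i hi j hj hij)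

/-- Symmetric L-shapes with long arms that are narrow compared to the play of the shape. -/
theorem exists_packsWithin_narrow :
    ∃ B : OnlineAlgorithm, B.PacksWithin
      (fun L => L.IsSymmetric ∧ 1 / 2 < L.lx ∧ 4 * L.wx ≤ 1 - L.lx) 10 1 := by
  -- The implication makes the choice total; shapes without play get class 0, but do not occur
  -- because `0 < 4 * wx ≤ 1 - lx`.
  have hcls : ∀ L : LShape, ∃ k : ℕ, 0 < 1 - L.lx →
      (1 / 2 : ℝ) ^ k / 2 < 1 - L.lx ∧ 1 - L.lx ≤ (1 / 2 : ℝ) ^ k := by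
    intro L
    by_cases h : 0 < 1 - L.lx
    · obtain ⟨k, hk⟩ := exists_dyadic_class h (by have := L.lx_pos; linarith)
      exact ⟨k, fun _ => hk⟩
    · exact ⟨0, fun h' => absurd h' h⟩
  choose cls hcls using hcls
  have hpos : ∀ k : ℕ, (0 : ℝ) < (1 / 2) ^ k := fun k => by positivity
  have hsep : ∀ k l : ℕ, k < l → (3 / 4 : ℝ) * (1 / 2) ^ l ≤ 3 / 8 * (1 / 2) ^ k := by
    intro k l h
    have := pow_le_pow_of_le_one (a := (1 / 2 : ℝ)) (by norm_num) (by norm_num)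
      (Nat.succ_le_of_lt h)
    rw [pow_succ] at this
    linarith
  -- With `r = 2⁻ᵏ`, starts are at most `3r/8 + r/8 = r/2`, which is less than the play, and widths
  -- are at most `r/4`, so stacks end by `3r/4`. The segment of class `k + 1` ends exactly where
  -- that of class `k` begins.
  refine exists_nextFit cls (fun k => 3 / 8 * (1 / 2) ^ k) (fun k => 1 / 8 * (1 / 2) ^ k)
    (fun k => 3 / 4 * (1 / 2) ^ k) 10 _ (fun L h => h.1) (fun k => by positivity)
    (fun k => by positivity) ?_ ?_ ?_ (by norm_num) ?_
  · rintro L ⟨-, -, h⟩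
    have := hcls L (by have := L.wx_pos; linarith)
    linarith
  · rintro L ⟨-, -, h⟩
    have := hcls L (by have := L.wx_pos; linarith)
    linarith
  · intro k l hkl
    rcases lt_or_gt_of_ne hkl with h | h
    · exact Or.inr (hsep k l h)
    · exact Or.inl (hsep l k h)
  · intro σ hσ k
    apply sum_le_mul_OPT
    intro s x y hf hd
    rw [← Finset.sum_filter]
    have hmem : ∀ i ∈ s.filter fun i => cls (σ.get i) = k, i ∈ s := fun i hi =>
      (Finset.mem_filter.1 hi).1
    have hcl : ∀ i ∈ s.filter fun i => cls (σ.get i) = k, 1 - (σ.get i).lx ≤ (1 / 2 : ℝ) ^ k := by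
      intro i hi
      have h1 := (hcls (σ.get i) (by
        have := (hσ _ (List.get_mem σ i)).2.2
        have := (σ.get i).wx_pos
        linarith)).2
      rwa [(Finset.mem_filter.1 hi).2] at h1
    have hbox := fun i hi => LShape.of_region_subset_unitBin (hf i (hmem i hi))
    have hk := hpos k
    -- Play plus largest width is at most `5r/4`, which is 10 times the threshold `r/8`.
    refine (sum_width_le_of_start_le _ x (fun i => (σ.get i).wx) (fun i _ => (σ.get i).wx_pos)
      (fun i hi => (hbox i hi).1) ?_ (t := (1 / 2) ^ k) (W := 1 / 4 * (1 / 2) ^ k) ?_ ?_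
      (by linarith)).trans (by linarith)
    · exact LShape.pairwise_separated (fun i hi => hf i (hmem i hi))
        (fun i hi j hj => hd i (hmem i hi) j (hmem j hj))
        fun i _ => ⟨(hσ _ (List.get_mem σ i)).1, (hσ _ (List.get_mem σ i)).2.1⟩
    · intro i hi
      have := hcl i hi
      have := (hσ _ (List.get_mem σ i)).2.2
      linarith
    · intro i hi
      have := hcl i hi
      have := hbox i hi
      linarith

/-! ### Wide shapes: online interval colouring -/

/-- An item covers the points of the diagonal that it occupies in its extreme position. -/
def LShape.Covers (L : LShape) (t : ℝ) : Prop := 1 - L.lx ≤ t ∧ t < 1 - L.lx + L.wx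

/-- Among items with private points, an item meets at most two others. -/
theorem LShape.not_three_covers {L : LShape} {f : Fin 3 → LShape} {u : Fin 3 → ℝ}
    (hf : ∀ c, (f c).Covers (u c)) (hff : ∀ c d, c ≠ d → ¬ (f c).Covers (u d))
    (hL : ∀ c, ¬ L.Covers (u c))
    (hmeet : ∀ c, ∃ q, L.Covers q ∧ (f c).Covers q) : False := by
  have hside : ∀ c d, c ≠ d → ¬ (u c < 1 - L.lx ∧ u d < 1 - L.lx) ∧
      ¬ (1 - L.lx + L.wx ≤ u c ∧ 1 - L.lx + L.wx ≤ u d) := by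
    intro c d hcd
    obtain ⟨p, hp1, hp2⟩ := hmeet c
    obtain ⟨q, hq1, hq2⟩ := hmeet d
    have h1 := hf c
    have h2 := hf d
    have h3 := hff c d hcd
    have h4 := hff d c hcd.symm
    simp only [LShape.Covers] at *
    constructor
    · rintro ⟨h5, h6⟩
      rcases le_total (u c) (u d) with h | h
      · exact h3 ⟨by linarith, by linarith⟩
      · exact h4 ⟨by linarith, by linarith⟩
    · rintro ⟨h5, h6⟩
      rcases le_total (u c) (u d) with h | h
      · exact h4 ⟨by linarith, by linarith⟩
      · exact h3 ⟨by linarith, by linarith⟩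
  have hcase : ∀ c, u c < 1 - L.lx ∨ 1 - L.lx + L.wx ≤ u c := by
    intro c
    by_contra! h
    exact hL c h
  have h01 := hside 0 1 (by decide)
  have h02 := hside 0 2 (by decide)
  have h12 := hside 1 2 (by decide)
  rcases hcase 0 with h0 | h0 <;> rcases hcase 1 with h1 | h1 <;> rcases hcase 2 with h2 | h2 <;>
    tauto

open Classical in
/-- The number of items that cover `t` and lie in one of the first `v` groups of three bins. -/
noncomputable def coverCount (h : List Entry) (v : ℕ) (t : ℝ) : ℕ :=
  h.countP fun e => e.2.bin / 3 < v ∧ e.1.Covers t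

open Classical in
theorem coverCount_succ_of_mem {h : List Entry} {v : ℕ} {t : ℝ} {e : Entry} (he : e ∈ h)
    (hv : e.2.bin / 3 = v) (ht : e.1.Covers t) : coverCount h v t + 1 ≤ coverCount h (v + 1) t := by
  induction h with
  | nil => simp at he
  | cons f h ih =>
    have hmono : coverCount h v t ≤ coverCount h (v + 1) t :=
      List.countP_mono_left fun f _ hf => by
        simp only [decide_eq_true_eq] at hf ⊢
        exact ⟨hf.1.trans v.lt_succ_self, hf.2⟩
    simp only [coverCount, List.countP_cons, decide_eq_true_eq] at hmono ih ⊢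
    rcases List.mem_cons.1 he with rfl | h1
    · rw [if_neg (fun h => by omega), if_pos ⟨by omega, ht⟩]
      omega
    · have := ih h1
      by_cases h2 : f.2.bin / 3 < v ∧ f.1.Covers t
      · rw [if_pos h2, if_pos ⟨h2.1.trans v.lt_succ_self, h2.2⟩]
        omega
      · rw [if_neg h2]
        omega

theorem coverCount_append_le (h : List Entry) (e : Entry) (v : ℕ) (t : ℝ) :
    coverCount h v t ≤ coverCount (h ++ [e]) v t := by
  rw [coverCount, coverCount, List.countP_append]
  omega

open Classical in
theorem coverCount_le_sum (h : List Entry) (v : ℕ) (t : ℝ) :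
    (coverCount h v t : ℝ) ≤ ((h.map Prod.fst).map fun L => if L.Covers t then (1 : ℝ) else 0).sum := by
  induction h with
  | nil => simp [coverCount]
  | cons f h ih =>
    simp only [coverCount, List.countP_cons, decide_eq_true_eq, List.map_cons,
      List.sum_cons] at ih ⊢
    push_cast
    by_cases h1 : f.1.Covers t
    · rw [if_pos h1]
      split_ifs <;> linarith
    · rw [if_neg h1, if_neg fun h => h1 h.2]
      linarith

/-- Symmetric L-shapes with long arms that are wide compared to the play of the shape: online
interval colouring. -/
theorem exists_packsWithin_wide :
    ∃ B : OnlineAlgorithm, B.PacksWithin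
      (fun L => L.IsSymmetric ∧ 1 / 2 < L.lx ∧ 1 - L.lx < 4 * L.wx) 15 0 := by
  classical
  refine exists_online _ 15 0 (fun h => Valid h ∧
    (∀ e ∈ h, (e.1.IsSymmetric ∧ 1 / 2 < e.1.lx ∧ 1 - e.1.lx < 4 * e.1.wx) ∧
      e.2.x = 1 - e.1.lx ∧ e.2.y = 1 - e.1.lx) ∧
    -- The level of an item is its group of three bins. Its point `t` is covered often at lower
    -- levels and is private within its level. Privacy is needed only between different bins, as the
    -- three items to be excluded come from three bins.
    ∀ e ∈ h, ∃ t, e.1.Covers t ∧ e.2.bin / 3 ≤ coverCount h (e.2.bin / 3) t ∧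
      ∀ f ∈ h, f.2.bin / 3 = e.2.bin / 3 → f.1.Covers t → f.2.bin = e.2.bin) ?_ ?_ ?_
  · exact ⟨valid_nil, by simp, by simp⟩
  · rintro h L ⟨hv, hP, hpriv⟩ hL
    -- The level is the least `v` for which levels up to `v` cover no point of `L` more than `v`
    -- times; minimality supplies the point `t`.
    have hex : ∃ v, ∀ t, L.Covers t → coverCount h (v + 1) t ≤ v :=
      ⟨h.length, fun t _ => List.countP_le_length⟩
    obtain ⟨v, hcheck, hmin⟩ : ∃ v, (∀ t, L.Covers t → coverCount h (v + 1) t ≤ v) ∧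
        ∃ t, L.Covers t ∧ v ≤ coverCount h v t := by
      refine ⟨Nat.find hex, Nat.find_spec hex, ?_⟩
      rcases Nat.eq_zero_or_pos (Nat.find hex) with h0 | h0
      · exact ⟨1 - L.lx, ⟨le_rfl, by have := L.wx_pos; linarith⟩, by omega⟩
      · have h1 := Nat.find_min hex (Nat.sub_lt h0 one_pos)
        push Not at h1
        obtain ⟨t, ht, h2⟩ := h1
        rw [show Nat.find hex - 1 + 1 = Nat.find hex by omega] at h2
        exact ⟨t, ht, by omega⟩
    obtain ⟨t, ht, hvt⟩ := hmin
    have hno : ∀ f ∈ h, f.2.bin / 3 = v → ¬ f.1.Covers t := by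
      intro f hf h1 h2
      have := coverCount_succ_of_mem hf h1 h2
      have := hcheck t ht
      omega
    -- If all three bins of the level were blocked, `L` would meet three items with private points.
    -- It covers none of these points, since each is already covered `v + 1` times.
    obtain ⟨c, hc⟩ : ∃ c : Fin 3, ∀ f ∈ h, f.2.bin = 3 * v + c →
        ∀ q, L.Covers q → ¬ f.1.Covers q := by
      by_contra! hcon
      choose f hf hfb hmeet using hcon
      have hlev : ∀ c, (f c).2.bin / 3 = v := fun c => by rw [hfb]; omega
      choose u hu hcnt hpr using fun c => hpriv (f c) (hf c)
      refine LShape.not_three_covers (L := L) (f := fun c => (f c).1) (u := u) hu ?_ ?_ hmeet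
      · intro c d hcd hcov
        have := hpr d (f c) (hf c) (by rw [hlev, hlev]) hcov
        rw [hfb, hfb] at this
        exact hcd (Fin.ext (by omega))
      · intro c hcov
        have h1 := hcheck _ hcov
        have h2 := coverCount_succ_of_mem (hf c) (hlev c) (hu c)
        have h3 := hcnt c
        rw [hlev] at h3
        omega
    have hlev : (3 * v + (c : ℕ)) / 3 = v := by omega
    have hL' := hL
    obtain ⟨⟨e1, e2⟩, e3, e4⟩ := hL'
    have hwx := L.wx_pos
    have hlx := L.lx_le
    refine ⟨⟨3 * v + c, 1 - L.lx, 1 - L.lx⟩, ?_, ?_, ?_⟩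
    · refine hv.concat ?_ ?_
      · apply LShape.region_subset_unitBin <;> dsimp <;> linarith
      · intro f hf
        apply disjoint_occ
        intro hb
        have h1 := hc f hf hb
        obtain ⟨⟨⟨f1, f2⟩, -⟩, f3, f4⟩ := hP f hf
        have hfw := f.1.wx_pos
        -- Two intervals that meet share the larger of their left ends.
        have h2 := h1 (max (1 - L.lx) (1 - f.1.lx))
        simp only [LShape.Covers, le_max_left, le_max_right, max_lt_iff, true_and, not_and] at h2
        by_cases h3 : 1 - f.1.lx < 1 - L.lx + L.wx
        · have h4 := h2 ⟨by linarith, h3⟩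
          have h5 : 1 - f.1.lx + f.1.wx ≤ 1 - L.lx := by
            by_contra! h6
            exact h4 h6 (by linarith)
          apply LShape.disjoint_of_nested <;> dsimp <;> linarith
        · apply Disjoint.symm
          apply LShape.disjoint_of_nested <;> dsimp <;> linarith
    · intro e he
      rcases List.mem_append.1 he with h1 | h1
      · exact hP e h1
      · rw [List.mem_singleton.1 h1]; exact ⟨hL, rfl, rfl⟩
    · intro e he
      rcases List.mem_append.1 he with h1 | h1
      · obtain ⟨q, hq, hcnt, hpr⟩ := hpriv e h1
        refine ⟨q, hq, hcnt.trans (coverCount_append_le _ _ _ _), ?_⟩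
        intro f hf hfl hfq
        rcases List.mem_append.1 hf with h2 | h2
        · exact hpr f h2 hfl hfq
        -- A new item of the same level cannot cover an old private point: its level check would
        -- fail there.
        · rw [List.mem_singleton.1 h2] at hfl hfq
          simp only [hlev] at hfl
          have h3 := hcheck q hfq
          have h4 := coverCount_succ_of_mem h1 hfl.symm hq
          rw [← hfl] at hcnt
          omega
      · rw [List.mem_singleton.1 h1]
        simp only [hlev]
        refine ⟨t, ht, hvt.trans (coverCount_append_le _ _ _ _), ?_⟩
        intro f hf hfl hfq
        rcases List.mem_append.1 hf with h2 | h2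
        · exact absurd hfq (hno f h2 hfl)
        · rw [List.mem_singleton.1 h2]
  · rintro h ⟨hv, hP, hpriv⟩
    refine ⟨hv, ?_⟩
    have hclique : ∀ t, ((h.map Prod.fst).map fun L => if L.Covers t then (1 : ℝ) else 0).sum ≤
        5 * OPT (h.map Prod.fst) := by
      intro t
      apply sum_le_mul_OPT
      intro s x y hf hd
      rw [← Finset.sum_filter, Finset.sum_const, nsmul_eq_mul, mul_one]
      have hmem : ∀ i ∈ s.filter fun i => ((h.map Prod.fst).get i).Covers t,
          i ∈ s ∧ ((h.map Prod.fst).get i).Covers t := fun i hi => Finset.mem_filter.1 hi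
      have hPi : ∀ i, ((h.map Prod.fst).get i).IsSymmetric ∧ 1 / 2 < ((h.map Prod.fst).get i).lx ∧
          1 - ((h.map Prod.fst).get i).lx < 4 * ((h.map Prod.fst).get i).wx := by
        intro i
        obtain ⟨e, he, h1⟩ := List.mem_map.1 (List.get_mem (h.map Prod.fst) i)
        rw [← h1]
        exact (hP e he).1
      have hbox := fun i hi => LShape.of_region_subset_unitBin (hf i (hmem i hi).1)
      -- An item covering `t` starts by `1 - lx ≤ t` in any packing, and `t < 1 - lx + wx < 5 * wx`.
      have := card_le_of_start_le _ x (fun i => ((h.map Prod.fst).get i).wx)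
        (fun i _ => LShape.wx_pos _) (fun i hi => (hbox i hi).1)
        (LShape.pairwise_separated (fun i hi => hf i (hmem i hi).1)
          (fun i hi j hj => hd i (hmem i hi).1 j (hmem j hj).1)
          fun i _ => ⟨(hPi i).1, (hPi i).2.1⟩) (t := t) (n := 5) ?_ ?_
      · exact_mod_cast this
      · intro i hi
        have h1 := (hmem i hi).2.2
        have h2 := (hPi i).2.2
        push_cast
        linarith
      · intro i hi
        have h1 := (hmem i hi).2.1
        have h2 := hbox i hi
        linarith
    have hsub : usedBins h ⊆ Finset.range (15 * OPT (h.map Prod.fst)) := by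
      intro n hn
      simp only [usedBins, List.mem_toFinset, List.mem_map] at hn
      obtain ⟨e, he, rfl⟩ := hn
      obtain ⟨t, ht, hcnt, -⟩ := hpriv e he
      have h1 := coverCount_succ_of_mem he rfl ht
      have h2 := (coverCount_le_sum h (e.2.bin / 3 + 1) t).trans (hclique t)
      have h3 : coverCount h (e.2.bin / 3 + 1) t ≤ 5 * OPT (h.map Prod.fst) := by exact_mod_cast h2
      rw [Finset.mem_range]
      omega
    have h1 := Finset.card_le_card hsub
    rw [Finset.card_range] at h1
    rw [add_zero]
    exact_mod_cast h1

theorem exists_packsWithin_large : ∃ B : OnlineAlgorithm,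
    B.PacksWithin (fun L => L.IsLarge ∧ L.IsSymmetric) 33 2 := by
  obtain ⟨B₁, h₁⟩ := exists_packsWithin_half
  obtain ⟨B₂, h₂⟩ := exists_packsWithin_narrow
  obtain ⟨B₃, h₃⟩ := exists_packsWithin_wide
  obtain ⟨B₄, h₄⟩ := exists_packsWithin_or (by norm_num) (by norm_num) h₁ h₂
  obtain ⟨B₅, h₅⟩ := exists_packsWithin_or (by norm_num) (by norm_num) h₄ h₃
  -- The three kinds together give ratio `4 + 10 + 15 = 29`, within 33.
  refine ⟨B₅, h₅.mono ?_ (by norm_num) (by norm_num)⟩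
  rintro L ⟨hl, hs⟩
  rcases hl.1.eq_or_lt with h | h
  · exact Or.inl (Or.inl ⟨hs, h.symm⟩)
  · rcases le_or_gt (4 * L.wx) (1 - L.lx) with h' | h'
    · exact Or.inl (Or.inr ⟨hs, h, h'⟩)
    · exact Or.inr ⟨hs, h, h'⟩

/-! ### Small shapes: dyadic blocks -/

/-- A dyadic block of width `2⁻ⁱ` and height `2⁻ʲ` with lower left corner `(u, v)` in bin `bin`,
filled diagonally up to `(u + X, v + Y)`. It is fresh, that is, not yet assigned to items, or open. -/
structure Block where
  bin : ℕ
  i : ℕ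
  j : ℕ
  u : ℝ
  v : ℝ
  X : ℝ
  Y : ℝ
  fresh : Bool

namespace Block

noncomputable def a (B : Block) : ℝ := (1 / 2) ^ B.i

noncomputable def b (B : Block) : ℝ := (1 / 2) ^ B.j

theorem a_pos (B : Block) : 0 < B.a := by unfold a; positivity

theorem b_pos (B : Block) : 0 < B.b := by unfold b; positivity

/-- The part of the block to the upper right of its contents. -/
def free (B : Block) : Set (ℕ × (ℝ × ℝ)) :=
  {B.bin} ×ˢ (Set.Ioo (B.u + B.X) (B.u + B.a) ×ˢ Set.Ioo (B.v + B.Y) (B.v + B.b))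

def key (B : Block) : (ℕ × ℕ) × Bool := ((B.i, B.j), B.fresh)

/-- The block lies inside its bin, and it is not yet filled up to half of its width or height. -/
structure Proper (B : Block) : Prop where
  u0 : 0 ≤ B.u
  v0 : 0 ≤ B.v
  u1 : B.u + B.a ≤ 1
  v1 : B.v + B.b ≤ 1
  X0 : 0 ≤ B.X
  Y0 : 0 ≤ B.Y
  X1 : B.X ≤ B.a / 2
  Y1 : B.Y ≤ B.b / 2

/-- The area of the block minus eight times a lower bound for the weight of its contents. -/
noncomputable def pot (B : Block) : ℝ := B.a * B.b - 2 * max (B.b * B.X) (B.a * B.Y)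

end Block

/-- The blocks `R` are disjoint, avoid the placed items, and account for all of the first `N` bins
except for a part whose area is at most eight times the weight of the items. -/
structure Partitions (h : List Entry) (N : ℕ) (R : Finset Block) : Prop where
  valid : Valid h
  bin_lt : ∀ e ∈ h, e.2.bin < N
  block_lt : ∀ B ∈ R, B.bin < N
  proper : ∀ B ∈ R, B.Proper
  disj : ∀ B ∈ R, ∀ C ∈ R, B ≠ C → Disjoint B.free C.free
  avoid : ∀ e ∈ h, ∀ B ∈ R, Disjoint (occ e) B.free
  count : (N : ℝ) ≤ 8 * ((h.map Prod.fst).map LShape.weight).sum + ∑ B ∈ R, B.pot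

/-- At most one fresh and one open block of each size, and no fresh full bin. -/
structure Sparse (R : Finset Block) : Prop where
  inj : ∀ B ∈ R, ∀ C ∈ R, B.key = C.key → B = C
  fresh_size : ∀ B ∈ R, B.fresh = true → 1 ≤ B.i + B.j
  fresh_empty : ∀ B ∈ R, B.fresh = true → B.X = 0 ∧ B.Y = 0

theorem Sparse.subset {R S : Finset Block} (hS : Sparse S) (h : R ⊆ S) : Sparse R :=
  ⟨fun B hB C hC => hS.inj B (h hB) C (h hC), fun B hB => hS.fresh_size B (h hB),
    fun B hB => hS.fresh_empty B (h hB)⟩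

open Classical in
theorem Sparse.insert_block {R : Finset Block} (hR : Sparse R) {B : Block}
    (hB : ∀ C ∈ R, C.key ≠ B.key) (hB' : B.fresh = true → 1 ≤ B.i + B.j)
    (hB'' : B.fresh = true → B.X = 0 ∧ B.Y = 0) :
    Sparse (insert B R) := by
  refine ⟨?_, ?_, ?_⟩
  · intro C hC D hD h
    rcases Finset.mem_insert.1 hC with hC' | hC <;> rcases Finset.mem_insert.1 hD with hD' | hD
    · rw [hC', hD']
    · exact absurd (hC' ▸ h.symm) (hB D hD)
    · exact absurd (hD' ▸ h) (hB C hC)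
    · exact hR.inj C hC D hD h
  · intro C hC
    rcases Finset.mem_insert.1 hC with rfl | hC
    · exact hB'
    · exact hR.fresh_size C hC
  · intro C hC
    rcases Finset.mem_insert.1 hC with rfl | hC
    · exact hB''
    · exact hR.fresh_empty C hC

theorem geom_range_le (K : ℕ) : ∑ i ∈ Finset.range K, (1 / 2 : ℝ) ^ i ≤ 2 := by
  have h := geom_sum_eq (x := (1 / 2 : ℝ)) (by norm_num) K
  rw [h]
  have : (0 : ℝ) < (1 / 2) ^ K := by positivity
  rw [div_le_iff_of_neg (by norm_num)]
  linarith

theorem sum_block_area_le (S : Finset (ℕ × ℕ)) :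
    ∑ c ∈ S, (1 / 2 : ℝ) ^ c.1 * (1 / 2) ^ c.2 ≤ 4 := by
  obtain ⟨K, hK⟩ : ∃ K, S ⊆ Finset.range K ×ˢ Finset.range K := by
    refine ⟨S.sup (fun c => c.1 + c.2) + 1, fun c hc => ?_⟩
    have := Finset.le_sup (f := fun c : ℕ × ℕ => c.1 + c.2) hc
    rw [Finset.mem_product, Finset.mem_range, Finset.mem_range]
    omega
  refine (Finset.sum_le_sum_of_subset_of_nonneg hK fun c _ _ => by positivity).trans ?_
  rw [Finset.sum_product, ← Finset.sum_mul_sum]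
  have h := geom_range_le K
  have h0 : 0 ≤ ∑ i ∈ Finset.range K, (1 / 2 : ℝ) ^ i := Finset.sum_nonneg fun i _ => by positivity
  nlinarith

open Classical in
/-- Blocks of distinct sizes have total area at most `4`. -/
theorem sum_pot_le_sum_area {R : Finset Block} (hR : ∀ B ∈ R, ∀ C ∈ R, (B.i, B.j) = (C.i, C.j) → B = C)
    (hp : ∀ B ∈ R, B.Proper) :
    ∑ B ∈ R, B.pot ≤ ∑ c ∈ R.image fun B => (B.i, B.j), (1 / 2 : ℝ) ^ c.1 * (1 / 2) ^ c.2 := by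
  rw [Finset.sum_image fun B hB C hC => hR B hB C hC]
  apply Finset.sum_le_sum
  intro B hB
  have h1 : 0 ≤ B.b * B.X := mul_nonneg B.b_pos.le (hp B hB).X0
  have h2 := le_max_left (B.b * B.X) (B.a * B.Y)
  simp only [Block.pot, Block.a, Block.b] at *
  linarith

theorem Sparse.sum_pot_le {R : Finset Block} (hR : Sparse R) (hp : ∀ B ∈ R, B.Proper) :
    ∑ B ∈ R, B.pot ≤ 7 := by
  classical
  rw [← Finset.sum_filter_add_sum_filter_not R fun B => B.fresh = true]
  have h1 := sum_pot_le_sum_area (R := R.filter fun B => B.fresh = true) (by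
    intro B hB C hC h
    rw [Finset.mem_filter] at hB hC
    exact hR.inj B hB.1 C hC.1 (by rw [Block.key, Block.key, h, hB.2, hC.2]))
    fun B hB => hp B (Finset.mem_filter.1 hB).1
  have h2 := sum_pot_le_sum_area (R := R.filter fun B => ¬ B.fresh = true) (by
    intro B hB C hC h
    rw [Finset.mem_filter, Bool.not_eq_true] at hB hC
    exact hR.inj B hB.1 C hC.1 (by rw [Block.key, Block.key, h, hB.2, hC.2]))
    fun B hB => hp B (Finset.mem_filter.1 hB).1
  have h3 := h2.trans (sum_block_area_le _)
  set S := (R.filter fun B => B.fresh = true).image fun B => (B.i, B.j)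
  have h0 : ((0, 0) : ℕ × ℕ) ∉ S := by
    intro h
    obtain ⟨B, hB, h4⟩ := Finset.mem_image.1 h
    rw [Finset.mem_filter] at hB
    have := hR.fresh_size B hB.1 hB.2
    simp only [Prod.mk.injEq] at h4
    omega
  -- No fresh block is a full bin, so adding that size shows that fresh blocks have area at most `4
  -- - 1`; the open ones add at most 4.
  have h4 := sum_block_area_le (insert (0, 0) S)
  rw [Finset.sum_insert h0] at h4
  norm_num at h4 h1 h3 ⊢
  linarith

open Classical in
/-- A block can be replaced by two disjoint parts of it that carry its potential. -/
theorem Partitions.split {h : List Entry} {N : ℕ} {R : Finset Block} {P B C : Block}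
    (hP : P ∉ R) (hR : Partitions h N (insert P R)) (hB : B.Proper) (hC : C.Proper)
    (hBb : B.bin = P.bin) (hCb : C.bin = P.bin)
    (hBP : B.free ⊆ P.free) (hCP : C.free ⊆ P.free) (hBC : Disjoint B.free C.free)
    (hpot : P.pot = B.pot + C.pot) (hne : B ≠ C) (hBR : B ∉ R) (hCR : C ∉ R) :
    Partitions h N (insert B (insert C R)) := by
  have hPm : P ∈ insert P R := Finset.mem_insert_self _ _
  have hPR : ∀ D ∈ R, Disjoint P.free D.free := fun D hD =>
    hR.disj P hPm D (Finset.mem_insert_of_mem hD) fun h => hP (h ▸ hD)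
  refine ⟨hR.valid, hR.bin_lt, ?_, ?_, ?_, ?_, ?_⟩
  · intro D hD
    rcases Finset.mem_insert.1 hD with rfl | hD
    · rw [hBb]; exact hR.block_lt P hPm
    rcases Finset.mem_insert.1 hD with rfl | hD
    · rw [hCb]; exact hR.block_lt P hPm
    exact hR.block_lt D (Finset.mem_insert_of_mem hD)
  · intro D hD
    rcases Finset.mem_insert.1 hD with rfl | hD
    · exact hB
    rcases Finset.mem_insert.1 hD with rfl | hD
    · exact hC
    exact hR.proper D (Finset.mem_insert_of_mem hD)
  · intro D hD E hE hDE
    simp only [Finset.mem_insert] at hD hE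
    rcases hD with hD | hD | hD <;> rcases hE with hE | hE | hE
    · exact absurd (hD.trans hE.symm) hDE
    · rw [hD, hE]; exact hBC
    · rw [hD]; exact (hPR E hE).mono_left hBP
    · rw [hD, hE]; exact hBC.symm
    · exact absurd (hD.trans hE.symm) hDE
    · rw [hD]; exact (hPR E hE).mono_left hCP
    · rw [hE]; exact ((hPR D hD).mono_left hBP).symm
    · rw [hE]; exact ((hPR D hD).mono_left hCP).symm
    · exact hR.disj D (Finset.mem_insert_of_mem hD) E (Finset.mem_insert_of_mem hE) hDE
  · intro e he D hD
    rcases Finset.mem_insert.1 hD with rfl | hD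
    · exact (hR.avoid e he P hPm).mono_right hBP
    rcases Finset.mem_insert.1 hD with rfl | hD
    · exact (hR.avoid e he P hPm).mono_right hCP
    exact hR.avoid e he D (Finset.mem_insert_of_mem hD)
  · have h1 := hR.count
    rw [Finset.sum_insert hP] at h1
    rw [Finset.sum_insert (by simp [hne, hBR]), Finset.sum_insert hCR]
    linarith

/-- The empty block of size `2⁻ⁱ × 2⁻ʲ` with lower left corner `(u, v)`. -/
def freshBlock (n i j : ℕ) (u v : ℝ) : Block := ⟨n, i, j, u, v, 0, 0, true⟩

theorem freshBlock_pot (n i j : ℕ) (u v : ℝ) :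
    (freshBlock n i j u v).pot = (1 / 2) ^ i * (1 / 2) ^ j := by
  simp [freshBlock, Block.pot, Block.a, Block.b]

theorem freshBlock_free (n i j : ℕ) (u v : ℝ) :
    (freshBlock n i j u v).free =
      {n} ×ˢ (Set.Ioo u (u + (1 / 2) ^ i) ×ˢ Set.Ioo v (v + (1 / 2) ^ j)) := by
  simp [freshBlock, Block.free, Block.a, Block.b]

theorem freshBlock_proper_iff {n i j : ℕ} {u v : ℝ} : (freshBlock n i j u v).Proper ↔
    0 ≤ u ∧ 0 ≤ v ∧ u + (1 / 2) ^ i ≤ 1 ∧ v + (1 / 2) ^ j ≤ 1 := by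
  constructor
  · intro h
    exact ⟨h.u0, h.v0, h.u1, h.v1⟩
  · rintro ⟨h1, h2, h3, h4⟩
    have ha := (freshBlock n i j u v).a_pos
    have hb := (freshBlock n i j u v).b_pos
    exact ⟨h1, h2, h3, h4, le_rfl, le_rfl, by simp only [freshBlock] at *; linarith,
      by simp only [freshBlock] at *; linarith⟩

open Classical in
/-- A fresh block of the given size can be taken off any sparse partition. -/
def Requestable (h : List Entry) (i j : ℕ) : Prop :=
  ∀ (N : ℕ) (R : Finset Block), Partitions h N R → Sparse R →
    ∃ (N' : ℕ) (R' : Finset Block) (n : ℕ) (u v : ℝ),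
      freshBlock n i j u v ∉ R' ∧ Partitions h N' (insert (freshBlock n i j u v) R') ∧ Sparse R' ∧
      ∀ B ∈ R', B ∈ R ∨ B.fresh = true ∧ B.i + B.j ≤ i + j

/-- A new bin is opened; the potential 1 of its block pays for the increase of `N`. -/
theorem requestable_zero (h : List Entry) : Requestable h 0 0 := by
  classical
  intro N R hR hS
  have hbin : ∀ B ∈ R, B.bin ≠ N := fun B hB => (hR.block_lt B hB).ne
  have hnot : freshBlock N 0 0 0 0 ∉ R := fun hB => hbin _ hB rfl
  have hdisj : ∀ B ∈ R, Disjoint B.free (freshBlock N 0 0 0 0).free := by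
    intro B hB
    rw [Set.disjoint_left]
    rintro ⟨m, q⟩ ⟨h1, -⟩ ⟨h2, -⟩
    simp only [Set.mem_singleton_iff] at h1 h2
    exact hbin B hB (h1.symm.trans h2)
  refine ⟨N + 1, R, N, 0, 0, hnot, ⟨hR.valid, fun e he => (hR.bin_lt e he).trans N.lt_succ_self,
    ?_, ?_, ?_, ?_, ?_⟩, hS, fun B hB => Or.inl hB⟩
  · intro B hB
    rcases Finset.mem_insert.1 hB with rfl | hB
    · exact N.lt_succ_self
    · exact (hR.block_lt B hB).trans N.lt_succ_self
  · intro B hB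
    rcases Finset.mem_insert.1 hB with rfl | hB
    · rw [freshBlock_proper_iff]; norm_num
    · exact hR.proper B hB
  · intro B hB C hC hBC
    rcases Finset.mem_insert.1 hB with hB | hB <;> rcases Finset.mem_insert.1 hC with hC | hC
    · exact absurd (hB.trans hC.symm) hBC
    · rw [hB]; exact (hdisj C hC).symm
    · rw [hC]; exact hdisj B hB
    · exact hR.disj B hB C hC hBC
  · intro e he B hB
    rcases Finset.mem_insert.1 hB with rfl | hB
    · rw [Set.disjoint_left]
      rintro ⟨m, q⟩ ⟨h1, -⟩ ⟨h2, -⟩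
      simp only [Set.mem_singleton_iff] at h1 h2
      exact (hR.bin_lt e he).ne (h1.symm.trans h2)
    · exact hR.avoid e he B hB
  · have := hR.count
    rw [Finset.sum_insert hnot, freshBlock_pot]
    rw [pow_zero, mul_one]
    push_cast
    linarith

/-- A fresh block of the size is reused if there is one; otherwise a parent is halved and the other
half kept as fresh. Fresh blocks left over from obtaining the parent are no finer than the parent,
so the kept half duplicates no size. -/
theorem Requestable.of_parent {h : List Entry} {i j i' j' : ℕ} (hlt : i' + j' < i + j)
    (hr : Requestable h i' j')
    (hsplit : ∀ (n : ℕ) (u v : ℝ), (freshBlock n i' j' u v).Proper → ∃ u' v',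
      (freshBlock n i j u v).Proper ∧ (freshBlock n i j u' v').Proper ∧
      (freshBlock n i j u v).free ⊆ (freshBlock n i' j' u v).free ∧
      (freshBlock n i j u' v').free ⊆ (freshBlock n i' j' u v).free ∧
      Disjoint (freshBlock n i j u v).free (freshBlock n i j u' v').free ∧
      freshBlock n i j u v ≠ freshBlock n i j u' v')
    (harea : ((1 / 2) ^ i' * (1 / 2) ^ j' : ℝ) = 2 * ((1 / 2) ^ i * (1 / 2) ^ j)) :
    Requestable h i j := by
  classical
  intro N R hR hS
  by_cases hex : ∃ B ∈ R, B.key = ((i, j), true)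
  · obtain ⟨B, hB, hk⟩ := hex
    simp only [Block.key, Prod.mk.injEq] at hk
    obtain ⟨⟨h1, h2⟩, h3⟩ := hk
    obtain ⟨h4, h5⟩ := hS.fresh_empty B hB h3
    have hBeq : freshBlock B.bin i j B.u B.v = B := by
      rw [freshBlock, ← h1, ← h2]
      cases B
      simp_all
    refine ⟨N, R.erase B, B.bin, B.u, B.v, ?_, ?_, hS.subset (Finset.erase_subset _ _),
      fun C hC => Or.inl (Finset.mem_of_mem_erase hC)⟩
    · rw [hBeq]; exact Finset.notMem_erase _ _
    · rw [hBeq, Finset.insert_erase hB]; exact hR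
  · push Not at hex
    obtain ⟨N', R', n, u, v, h1, h2, h3, h4⟩ := hr N R hR hS
    obtain ⟨u', v', s1, s2, s3, s4, s5, s6⟩ := hsplit n u v (h2.proper _ (Finset.mem_insert_self _ _))
    have hkey : ∀ B ∈ R', B.key ≠ ((i, j), true) := by
      intro B hB hk
      rcases h4 B hB with h5 | ⟨-, h5⟩
      · exact hex B h5 hk
      · simp only [Block.key, Prod.mk.injEq] at hk
        omega
    have hB : ∀ u v, freshBlock n i j u v ∉ R' := fun u v hm => hkey _ hm rfl
    refine ⟨N', insert (freshBlock n i j u' v') R', n, u, v, ?_, ?_, ?_, ?_⟩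
    · rw [Finset.mem_insert, not_or]
      exact ⟨s6, hB u v⟩
    · exact h2.split h1 s1 s2 rfl rfl s3 s4 s5
        (by rw [freshBlock_pot, freshBlock_pot, freshBlock_pot, harea]; ring) s6 (hB _ _) (hB _ _)
    · exact h3.insert_block hkey (fun _ => by simp only [freshBlock]; omega) fun _ => ⟨rfl, rfl⟩
    · intro C hC
      rcases Finset.mem_insert.1 hC with rfl | hC
      · exact Or.inr ⟨rfl, le_rfl⟩
      · exact (h4 C hC).imp_right fun h => ⟨h.1, by omega⟩

theorem requestable (h : List Entry) (i j : ℕ) : Requestable h i j := by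
  have hp : ∀ k : ℕ, (0 : ℝ) < (1 / 2) ^ k := fun k => by positivity
  induction j with
  | succ j ih =>
    refine Requestable.of_parent (i' := i) (j' := j) (by omega) ih ?_ (by rw [pow_succ]; ring)
    intro n u v hP
    have h2 := hp j
    have h3 : ((1 / 2) ^ (j + 1) : ℝ) = (1 / 2) ^ j / 2 := by rw [pow_succ]; ring
    refine ⟨u, v + (1 / 2) ^ (j + 1), ?_⟩
    simp only [freshBlock_proper_iff, freshBlock_free, h3] at hP ⊢
    obtain ⟨p1, p2, p3, p4⟩ := hP
    refine ⟨⟨p1, p2, p3, by linarith⟩, ⟨p1, by linarith, p3, by linarith⟩, ?_, ?_, ?_, ?_⟩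
    · exact Set.prod_mono_right (Set.prod_mono_right (Set.Ioo_subset_Ioo_right (by linarith)))
    · exact Set.prod_mono_right (Set.prod_mono_right (Set.Ioo_subset_Ioo (by linarith)
        (by linarith)))
    · rw [Set.disjoint_left]
      rintro ⟨m, q⟩ ⟨-, -, h4⟩ ⟨-, -, h5⟩
      exact lt_asymm h4.2 h5.1
    · intro h4
      have := congrArg Block.v h4
      simp only [freshBlock] at this
      linarith
  | zero =>
    induction i with
    | zero => exact requestable_zero h
    | succ i ih =>
      refine Requestable.of_parent (i' := i) (j' := 0) (by omega) ih ?_ (by rw [pow_succ]; ring)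
      intro n u v hP
      have h2 := hp i
      have h3 : ((1 / 2) ^ (i + 1) : ℝ) = (1 / 2) ^ i / 2 := by rw [pow_succ]; ring
      refine ⟨u + (1 / 2) ^ (i + 1), v, ?_⟩
      simp only [freshBlock_proper_iff, freshBlock_free, h3] at hP ⊢
      obtain ⟨p1, p2, p3, p4⟩ := hP
      refine ⟨⟨p1, p2, by linarith, p4⟩, ⟨by linarith, p2, by linarith, p4⟩, ?_, ?_, ?_, ?_⟩
      · exact Set.prod_mono_right (Set.prod_mono_left (Set.Ioo_subset_Ioo_right (by linarith)))
      · exact Set.prod_mono_right (Set.prod_mono_left (Set.Ioo_subset_Ioo (by linarith)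
          (by linarith)))
      · rw [Set.disjoint_left]
        rintro ⟨m, q⟩ ⟨-, h4, -⟩ ⟨-, h5, -⟩
        exact lt_asymm h4.2 h5.1
      · intro h4
        have := congrArg Block.u h4
        simp only [freshBlock] at this
        linarith

/-- The placement of the next item in a block. -/
noncomputable def Block.next (B : Block) : Placement := ⟨B.bin, B.u + B.X, B.v + B.Y⟩

/-- The block after an item was placed in it. -/
noncomputable def Block.push (B : Block) (L : LShape) : Block :=
  { B with X := B.X + L.wx, Y := B.Y + L.wy, fresh := false }

theorem Block.push_free_subset (B : Block) (L : LShape) : (B.push L).free ⊆ B.free := by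
  have h1 := L.wx_pos
  have h2 := L.wy_pos
  refine Set.prod_mono_right (Set.prod_mono (Set.Ioo_subset_Ioo_left ?_)
    (Set.Ioo_subset_Ioo_left ?_)) <;> simp only [Block.push] <;> linarith

theorem Block.Proper.occ_subset {B : Block} (hB : B.Proper) {L : LShape} (h1 : L.lx ≤ B.a / 2)
    (h2 : L.ly ≤ B.b / 2) : occ (L, B.next) ⊆ B.free := by
  have h3 := hB.X1
  have h4 := hB.Y1
  exact Set.prod_mono_right ((L.interior_region_subset _ _).trans
    (Set.prod_mono (Set.Ioo_subset_Ioo_right (by simp only [Block.next]; linarith))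
      (Set.Ioo_subset_Ioo_right (by simp only [Block.next]; linarith))))

theorem Block.disjoint_push (B : Block) (L : LShape) :
    Disjoint (occ (L, B.next)) (B.push L).free := by
  have h : Disjoint (interior (L.region B.next.x B.next.y))
      (Set.Ioi (B.u + B.X + L.wx) ×ˢ Set.Ioi (B.v + B.Y + L.wy)) :=
    LShape.disjoint_notch le_rfl le_rfl
  rw [Set.disjoint_left] at h ⊢
  rintro ⟨n, q⟩ ⟨-, h1⟩ ⟨-, h2, h3⟩
  refine h h1 ⟨?_, ?_⟩
  · have := h2.1
    simp only [Block.push] at this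
    simp only [Set.mem_Ioi]
    linarith
  · have := h3.1
    simp only [Block.push] at this
    simp only [Set.mem_Ioi]
    linarith

/-- Since `lx ≥ a/4` and `ly ≥ b/4`, both `b * wx` and `a * wy` are at most four times the weight;
the potential doubles this. -/
theorem Block.pot_le_pot_push (B : Block) {L : LShape} (h1 : B.a / 2 / 2 ≤ L.lx)
    (h2 : B.b / 2 / 2 ≤ L.ly) : B.pot ≤ (B.push L).pot + 8 * L.weight := by
  have h3 : L.lx * L.wy ≤ L.weight := le_max_left _ _
  have h4 : L.wx * L.ly ≤ L.weight := le_max_right _ _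
  have h5 := mul_le_mul_of_nonneg_right h1 L.wy_pos.le
  have h6 := mul_le_mul_of_nonneg_left h2 L.wx_pos.le
  have h7 : max (B.b * (B.X + L.wx)) (B.a * (B.Y + L.wy)) ≤
      max (B.b * B.X) (B.a * B.Y) + 4 * L.weight := by
    have h8 := le_max_left (B.b * B.X) (B.a * B.Y)
    have h9 := le_max_right (B.b * B.X) (B.a * B.Y)
    apply max_le <;> linarith
  have h10 : (B.push L).pot = B.a * B.b - 2 * max (B.b * (B.X + L.wx)) (B.a * (B.Y + L.wy)) := rfl
  rw [h10, Block.pot]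
  linarith

/-- Past half in one direction, twice the maximum exceeds the area, so the block can be dropped from
the count. -/
theorem Block.pot_push_nonpos (B : Block) {L : LShape}
    (h : ¬ (B.X + L.wx ≤ B.a / 2 ∧ B.Y + L.wy ≤ B.b / 2)) : (B.push L).pot ≤ 0 := by
  have h10 : (B.push L).pot = B.a * B.b - 2 * max (B.b * (B.X + L.wx)) (B.a * (B.Y + L.wy)) := rfl
  have h8 := le_max_left (B.b * (B.X + L.wx)) (B.a * (B.Y + L.wy))
  have h9 := le_max_right (B.b * (B.X + L.wx)) (B.a * (B.Y + L.wy))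
  rw [h10]
  rw [not_and_or, not_le, not_le] at h
  rcases h with h | h
  · have := mul_lt_mul_of_pos_left h B.b_pos
    linarith
  · have := mul_lt_mul_of_pos_left h B.a_pos
    linarith

open Classical in
/-- An item can be placed in a block of its size. -/
theorem Partitions.place {h : List Entry} {N : ℕ} {R : Finset Block} {B : Block} (hB : B ∉ R)
    (hR : Partitions h N (insert B R)) {L : LShape} (hx : L.lx ≤ B.a / 2) (hy : L.ly ≤ B.b / 2)
    (hx' : B.a / 2 / 2 ≤ L.lx) (hy' : B.b / 2 / 2 ≤ L.ly) (hS : Sparse R)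
    (hkey : ∀ C ∈ R, C.key ≠ ((B.i, B.j), false)) :
    ∃ R', Partitions (h ++ [(L, B.next)]) N R' ∧ Sparse R' := by
  have hBm : B ∈ insert B R := Finset.mem_insert_self _ _
  have hp := hR.proper B hBm
  have hocc := hp.occ_subset hx hy
  have hBR : ∀ D ∈ R, Disjoint B.free D.free := fun D hD =>
    hR.disj B hBm D (Finset.mem_insert_of_mem hD) fun h => hB (h ▸ hD)
  have hvalid : Valid (h ++ [(L, B.next)]) := by
    refine hR.valid.concat ?_ fun f hf => (hR.avoid f hf B hBm).mono_right hocc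
    have h1 := hp.u0
    have h2 := hp.v0
    have h3 := hp.u1
    have h4 := hp.v1
    have h5 := hp.X0
    have h6 := hp.Y0
    have h7 := hp.X1
    have h8 := hp.Y1
    apply LShape.region_subset_unitBin <;> simp only [Block.next] <;> linarith
  have hbins : ∀ e ∈ h ++ [(L, B.next)], e.2.bin < N := by
    intro e he
    rcases List.mem_append.1 he with h1 | h1
    · exact hR.bin_lt e h1
    · rw [List.mem_singleton.1 h1]; exact hR.block_lt B hBm
  have havoid : ∀ e ∈ h ++ [(L, B.next)], ∀ C ∈ R, Disjoint (occ e) C.free := by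
    intro e he C hC
    rcases List.mem_append.1 he with h1 | h1
    · exact hR.avoid e h1 C (Finset.mem_insert_of_mem hC)
    · rw [List.mem_singleton.1 h1]; exact (hBR C hC).mono_left hocc
  have hcount := hR.count
  rw [Finset.sum_insert hB] at hcount
  have hpot := B.pot_le_pot_push hx' hy'
  have hsum : (((h ++ [(L, B.next)]).map Prod.fst).map LShape.weight).sum =
      ((h.map Prod.fst).map LShape.weight).sum + L.weight := by simp
  by_cases hfit : B.X + L.wx ≤ B.a / 2 ∧ B.Y + L.wy ≤ B.b / 2
  · have hnew : B.push L ∉ R := fun hm => hkey _ hm rfl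
    refine ⟨insert (B.push L) R, ⟨hvalid, hbins, ?_, ?_, ?_, ?_, ?_⟩,
      hS.insert_block hkey (fun h => absurd h (by simp [Block.push]))
        fun h => absurd h (by simp [Block.push])⟩
    · intro C hC
      rcases Finset.mem_insert.1 hC with rfl | hC
      · exact hR.block_lt B hBm
      · exact hR.block_lt C (Finset.mem_insert_of_mem hC)
    · intro C hC
      rcases Finset.mem_insert.1 hC with rfl | hC
      · exact ⟨hp.u0, hp.v0, hp.u1, hp.v1, add_nonneg hp.X0 L.wx_pos.le,
          add_nonneg hp.Y0 L.wy_pos.le, hfit.1, hfit.2⟩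
      · exact hR.proper C (Finset.mem_insert_of_mem hC)
    · intro C hC D hD hCD
      rcases Finset.mem_insert.1 hC with hC | hC <;> rcases Finset.mem_insert.1 hD with hD | hD
      · exact absurd (hC.trans hD.symm) hCD
      · rw [hC]; exact (hBR D hD).mono_left (B.push_free_subset L)
      · rw [hD]; exact ((hBR C hC).mono_left (B.push_free_subset L)).symm
      · exact hR.disj C (Finset.mem_insert_of_mem hC) D (Finset.mem_insert_of_mem hD) hCD
    · intro e he C hC
      rcases Finset.mem_insert.1 hC with rfl | hC
      · rcases List.mem_append.1 he with h1 | h1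
        · exact (hR.avoid e h1 B hBm).mono_right (B.push_free_subset L)
        · rw [List.mem_singleton.1 h1]; exact B.disjoint_push L
      · exact havoid e he C hC
    · rw [hsum, Finset.sum_insert hnew]
      linarith
  · refine ⟨R, ⟨hvalid, hbins, fun C hC => hR.block_lt C (Finset.mem_insert_of_mem hC),
      fun C hC => hR.proper C (Finset.mem_insert_of_mem hC), fun C hC D hD =>
        hR.disj C (Finset.mem_insert_of_mem hC) D (Finset.mem_insert_of_mem hD), havoid, ?_⟩, hS⟩
    have := B.pot_push_nonpos hfit
    rw [hsum]
    linarith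

theorem exists_packsWithin_small :
    ∃ A : OnlineAlgorithm, A.PacksWithin (fun L => L.IsSmall) 8 7 := by
  classical
  refine exists_online _ 8 7 (fun h => ∃ N R, Partitions h N R ∧ Sparse R) ?_ ?_ ?_
  · exact ⟨0, ∅, ⟨valid_nil, by simp, by simp, by simp, by simp, by simp, by simp⟩,
      ⟨by simp, by simp, by simp⟩⟩
  · rintro h L ⟨N, R, hR, hS⟩ ⟨hx, hy⟩
    -- Classing twice the arm length gives a block side between two and four times the arm;
    -- smallness makes the doubled arm at most 1.
    obtain ⟨i, hi, hi'⟩ := exists_dyadic_class (d := 2 * L.lx) (by have := L.lx_pos; linarith)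
      (by linarith)
    obtain ⟨j, hj, hj'⟩ := exists_dyadic_class (d := 2 * L.ly) (by have := L.ly_pos; linarith)
      (by linarith)
    by_cases hex : ∃ B ∈ R, B.key = ((i, j), false)
    · obtain ⟨B, hB, hk⟩ := hex
      have hk' := hk
      simp only [Block.key, Prod.mk.injEq] at hk
      obtain ⟨⟨rfl, rfl⟩, -⟩ := hk
      obtain ⟨R', h1⟩ := Partitions.place (Finset.notMem_erase B R)
        (by rwa [Finset.insert_erase hB]) (L := L) (by unfold Block.a; linarith)
        (by unfold Block.b; linarith) (by unfold Block.a; linarith) (by unfold Block.b; linarith)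
        (hS.subset (Finset.erase_subset _ _)) (fun C hC hCk =>
          Finset.ne_of_mem_erase hC (hS.inj C (Finset.mem_of_mem_erase hC) B hB
            (hCk.trans hk'.symm)))
      exact ⟨_, N, R', h1⟩
    · push Not at hex
      obtain ⟨N', R₁, n, u, v, h1, h2, h3, h4⟩ := requestable h i j N R hR hS
      obtain ⟨R', h5⟩ := h2.place h1 (L := L) (by simp only [freshBlock, Block.a]; linarith)
        (by simp only [freshBlock, Block.b]; linarith)
        (by simp only [freshBlock, Block.a]; linarith)
        (by simp only [freshBlock, Block.b]; linarith) h3 (fun C hC hCk => by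
          rcases h4 C hC with h6 | ⟨h6, -⟩
          · exact hex C h6 hCk
          · simp [Block.key, h6] at hCk)
      exact ⟨_, N', R', h5⟩
  · rintro h ⟨N, R, hR, hS⟩
    refine ⟨hR.valid, ?_⟩
    have hsub : usedBins h ⊆ Finset.range N := by
      intro n hn
      simp only [usedBins, List.mem_toFinset, List.mem_map] at hn
      obtain ⟨e, he, rfl⟩ := hn
      exact Finset.mem_range.2 (hR.bin_lt e he)
    have h1 := Finset.card_le_card hsub
    rw [Finset.card_range] at h1
    have h2 : ((usedBins h).card : ℝ) ≤ N := by exact_mod_cast h1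
    have h3 := hR.count
    have h4 := hS.sum_pot_le hR.proper
    have h5 := sum_weight_le_OPT (h.map Prod.fst)
    linarith

end LBinPack

theorem theorem1p3 :
    (∃ (A : LBinPack.OnlineAlgorithm) (c : ℝ),
      A.HasAsymptoticRatio (fun L => L.IsSymmetric ∨ L.IsSmall) c) ∧
    (∃ A : LBinPack.OnlineAlgorithm,
      A.PacksWithin (fun L => L.IsLarge ∧ L.IsSymmetric) 33 2) ∧
    (∃ A : LBinPack.OnlineAlgorithm,
      A.PacksWithin (fun L => L.IsSmall) 8 7) ∧
    (∃ A : LBinPack.OnlineAlgorithm,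
      A.PacksWithin (fun L => L.IsSymmetric) 41 9) := by
  obtain ⟨A₁, h₁⟩ := LBinPack.exists_packsWithin_large
  obtain ⟨A₂, h₂⟩ := LBinPack.exists_packsWithin_small
  obtain ⟨A, hA⟩ := LBinPack.exists_packsWithin_or (by norm_num) (by norm_num) h₁ h₂
  have hcases : ∀ L : LBinPack.LShape, L.IsSymmetric → (L.IsLarge ∧ L.IsSymmetric) ∨ L.IsSmall := by
    intro L hL
    rcases le_total (1 / 2) L.lx with h | h
    · exact Or.inl ⟨⟨h, hL.1 ▸ h⟩, hL⟩
    · exact Or.inr ⟨h, hL.1 ▸ h⟩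
  -- One combined algorithm, with `33 + 8` and `2 + 7`, serves both the mixed and the symmetric
  -- sequences.
  refine ⟨⟨A, 41, 9, by norm_num, hA.mono ?_ (by norm_num) (by norm_num)⟩, ⟨A₁, h₁⟩, ⟨A₂, h₂⟩, A,
    hA.mono hcases (by norm_num) (by norm_num)⟩
  rintro L (hL | hL)
  · exact hcases L hL
  · exact Or.inr hL
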